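/- Let $T>0$, $U\subset\mathbb R^m$, $f:[0,T]\times\mathbb R^n\times\mathbb R^m\to\mathbb R^n$ and $\psi^i:[0,T]\times\mathbb R^n\to\mathbb R$, $i=1,\dots,I$, and put $C(t)=\{x\in\mathbb R^n:\psi^i(t,x)\le 0,\ i=1,\dots,I\}$. Let $B_n$ be the closed unit ball of $\mathbb R^n$ and let $N_S(s)$ be the Mordukhovich (limiting) normal cone to $S$ at $s\in S$ (with $N_S(s)=\emptyset$ if $s\notin S$). Assume: (A1) The $\psi^i$ are $C^2$ on $[0,T]\times\mathbb R^n$; the graph $\{(t,x):t\in[0,T],\,x\in C(t)\}$ is compact and contained in the interior of the ball $rB_{n+1}$, $r>0$; and there are $\beta,\eta>0$ and $\rho\in(0,1)$ such that, for all $(t,x)\in[0,T]\times\mathbb R^n$ and with $I(t,x)=\{i:-2\beta<\psi^i(t,x)\le\beta\}$: (i) $|\psi^i(t,x)|\le\beta$ implies $|\nabla_x\psi^i(t,x)|>\eta$; (ii) $\langle\nabla_x\psi^i(t,x),\nabla_x\psi^j(t,x)\rangle\ge 0$ for $i,j\in I(t,x)$; (iii) $\sum_{j\in I(t,x)\setminus\{i\}}|\langle\nabla_x\psi^i(t,x),\nabla_x\psi^j(t,x)\rangle|\le\rho|\nabla_x\psi^i(t,x)|^2$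 for $i\in I(t,x)$; (iv) $\psi^i(t,x)\le-2\beta$ implies $\nabla_x\psi^i(t,x)=0$. (A2) $f$ is continuous, $x\mapsto f(t,x,u)$ is $C^1$ for all $(t,u)\in[0,T]\times\mathbb R^m$, and there is $M>0$ with $|f(t,x,u)|\le M$ and $|\nabla_xf(t,x,u)|\le M$ for all $(t,x)\in rB_{n+1}$ with $t\in[0,T]$ and all $u\in U$. (A3) $f(t,x,U)$ is convex for every $(t,x)\in[0,T]\times\mathbb R^n$. (A4) $U$ is compact. Let $\mu$ satisfy $|\nabla_x\psi^i(t,x)||f(t,x,u)|+|\partial_t\psi^i(t,x)|+1\le\mu$ for all $t\in[0,T]$, $u\in U$, $x\in C(t)+B_n$ and $i$. Let $\sigma_k\downarrow0$ and $\gamma_k\uparrow+\infty$ with $\gamma_k>0$; put $\mu_k=\frac1{\gamma_k}\log\frac{\mu}{\eta^2\gamma_k}$ and $C^k(t)=\{x:\psi^i(t,x)-\sigma_k\le\mu_k,\ i=1,\dots,I\}$, and assume $C(t)\subset\operatorname{int}C^k(t)$ for all $k$ and all $t\in[0,T]$. A control is a measurable function $u$ on $[0,T]$ with $u(t)\in U$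 for a.e. $t$. Solutions are absolutely continuous functions on $[0,T]$ that satisfy the relation in question for a.e. $t$. For a control $u$ and an initial point $b$ consider $$\dot x(t)=f(t,x(t),u(t))-\sum_{i=1}^I\gamma_ke^{\gamma_k(\psi^i(t,x(t))-\sigma_k)}\nabla_x\psi^i(t,x(t)),\qquad x(0)=b,\tag{1}$$ and, for $x_0\in\mathbb R^n$, $$\dot x(t)\in f(t,x(t),u(t))-N_{C(t)}(x(t)),\qquad x(0)=x_0.\tag{2}$$ Then the following hold. (a) Let $u_k$ be controls, let $b_k\in C^k(0)$ with $b_k\to x_0$, and for each $k$ let $x_k$ be a solution of (1) with $u=u_k$, $b=b_k$. Then a subsequence of $(x_k)$ converges uniformly on $[0,T]$ to some $x$ for which there is a control $u$ such that $x$ is the unique solution of (2). (b) For every control $u$, problem (2) has at most one solution. (c) If in (a) all the controls are equal, $u_k=u$, then $(x_k)$ converges uniformly on $[0,T]$ to the unique solution of (2) for this $u$. (d) Let $x$ be any solution of $\dot x(t)\in f(t,x(t),U)-N_{C(t)}(x(t))$, $x(0)=x_0$. Then there is a control $u$ such that $x$ solves (2) and such that, for every sequence $b_k\in C^k(0)$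 with $b_k\to x_0$ (for instance $b_k=x_0$), there are functions $x_k$ which, for all sufficiently large $k$, solve (1) with this $u$ and $b=b_k$, and which converge to $x$ uniformly on $[0,T]$. -/

import Mathlib

open Set Filter Topology MeasureTheory

/-- Regular (Fréchet) normals to `S` at `s ∈ S`; no normals at points outside `S`. -/
def regularNormalCone {n : ℕ} (S : Set (EuclideanSpace ℝ (Fin n)))
    (s : EuclideanSpace ℝ (Fin n)) : Set (EuclideanSpace ℝ (Fin n)) :=
  {v | s ∈ S ∧ ∀ ε : ℝ, 0 < ε → ∀ᶠ y in 𝓝[S] s, inner ℝ v (y - s) ≤ ε * ‖y - s‖}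

/-- The Mordukhovich (limiting) normal cone to `S` at `s ∈ S`: limits of regular normals at
points of `S` converging to `s`. It is empty at points outside `S`. -/
def limitingNormalCone {n : ℕ} (S : Set (EuclideanSpace ℝ (Fin n)))
    (s : EuclideanSpace ℝ (Fin n)) : Set (EuclideanSpace ℝ (Fin n)) :=
  {v | s ∈ S ∧ ∃ p w : ℕ → EuclideanSpace ℝ (Fin n),
    (∀ k, w k ∈ regularNormalCone S (p k)) ∧
      Tendsto p atTop (𝓝 s) ∧ Tendsto w atTop (𝓝 v)}

/-- `C(t) = {x | ψⁱ(t,x) ≤ 0 for all i}`. -/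
def movingSet {n I : ℕ} (ψ : Fin I → ℝ → EuclideanSpace ℝ (Fin n) → ℝ) (t : ℝ) :
    Set (EuclideanSpace ℝ (Fin n)) :=
  {x | ∀ i, ψ i t x ≤ 0}

/-- `I(t,x) = {i | -2β < ψⁱ(t,x) ≤ β}`, the indices of the nearly active constraints. -/
noncomputable def nearActive {n I : ℕ} (ψ : Fin I → ℝ → EuclideanSpace ℝ (Fin n) → ℝ) (β t : ℝ)
    (x : EuclideanSpace ℝ (Fin n)) : Finset (Fin I) :=
  Finset.univ.filter (fun i => -(2 * β) < ψ i t x ∧ ψ i t x ≤ β)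

/-- The assumptions on the functions `ψⁱ : [0,T] × ℝⁿ → ℝ` describing the moving set. -/
structure MovingSetAssumptions {n I : ℕ} (T : ℝ)
    (ψ : Fin I → ℝ → EuclideanSpace ℝ (Fin n) → ℝ) (r β η ρ : ℝ) : Prop where
  contDiffOn : ∀ i, ContDiffOn ℝ 2
    (fun p : ℝ × EuclideanSpace ℝ (Fin n) => ψ i p.1 p.2) (Icc 0 T ×ˢ univ)
  isCompact_graph : IsCompact
    {p : ℝ × EuclideanSpace ℝ (Fin n) | p.1 ∈ Icc 0 T ∧ p.2 ∈ movingSet ψ p.1}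
  r_pos : 0 < r
  graph_in_ball : ∀ t ∈ Icc 0 T, ∀ x ∈ movingSet ψ t, t ^ 2 + ‖x‖ ^ 2 < r ^ 2
  β_pos : 0 < β
  η_pos : 0 < η
  ρ_pos : 0 < ρ
  ρ_lt_one : ρ < 1
  gradient_bound : ∀ t ∈ Icc 0 T, ∀ x i, ψ i t x ∈ Icc (-β) β → η < ‖gradient (ψ i t) x‖
  inner_nonneg : ∀ t ∈ Icc 0 T, ∀ x, ∀ i ∈ nearActive ψ β t x, ∀ j ∈ nearActive ψ β t x,
    0 ≤ inner ℝ (gradient (ψ i t) x) (gradient (ψ j t) x)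
  diag_dominant : ∀ t ∈ Icc 0 T, ∀ x, ∀ i ∈ nearActive ψ β t x,
    ∑ j ∈ (nearActive ψ β t x).erase i,
      |(inner ℝ (gradient (ψ i t) x) (gradient (ψ j t) x) : ℝ)| ≤
        ρ * ‖gradient (ψ i t) x‖ ^ 2
  gradient_zero : ∀ t ∈ Icc 0 T, ∀ x i, ψ i t x ≤ -(2 * β) → gradient (ψ i t) x = 0

/-- The assumptions on the dynamics `f : [0,T] × ℝⁿ × ℝᵐ → ℝⁿ` and the control set `U`. -/
structure DynamicsAssumptions {n m : ℕ} (T : ℝ)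
    (f : ℝ → EuclideanSpace ℝ (Fin n) → EuclideanSpace ℝ (Fin m) → EuclideanSpace ℝ (Fin n))
    (U : Set (EuclideanSpace ℝ (Fin m))) (r M : ℝ) : Prop where
  continuousOn : ContinuousOn
    (fun p : ℝ × EuclideanSpace ℝ (Fin n) × EuclideanSpace ℝ (Fin m) => f p.1 p.2.1 p.2.2)
    (Icc 0 T ×ˢ univ)
  contDiff : ∀ t ∈ Icc 0 T, ∀ u, ContDiff ℝ 1 (fun x => f t x u)
  M_pos : 0 < M
  bound : ∀ t ∈ Icc 0 T, ∀ x, t ^ 2 + ‖x‖ ^ 2 ≤ r ^ 2 → ∀ u ∈ U, ‖f t x u‖ ≤ M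
  bound_fderiv : ∀ t ∈ Icc 0 T, ∀ x, t ^ 2 + ‖x‖ ^ 2 ≤ r ^ 2 → ∀ u ∈ U,
    ‖fderiv ℝ (fun y => f t y u) x‖ ≤ M
  convex_image : ∀ t ∈ Icc 0 T, ∀ x, Convex ℝ (f t x '' U)
  isCompact_U : IsCompact U

/-- `μ(γ) = (1/γ) log (μ / (η² γ))`. -/
noncomputable def penaltyLevel (μ η γ : ℝ) : ℝ := 1 / γ * Real.log (μ / (η ^ 2 * γ))

/-- The enlarged set `{x | ψⁱ(t,x) - σ ≤ μ(γ) for all i}`. -/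
def enlargedSet {n I : ℕ} (ψ : Fin I → ℝ → EuclideanSpace ℝ (Fin n) → ℝ) (μ η γ σ t : ℝ) :
    Set (EuclideanSpace ℝ (Fin n)) :=
  {x | ∀ i, ψ i t x - σ ≤ penaltyLevel μ η γ}

/-- The sequences `σₖ ↓ 0` and `γₖ ↑ ∞` of penalty parameters, together with the constant `μ`. -/
structure PenaltyParameters {n m I : ℕ} (T : ℝ)
    (f : ℝ → EuclideanSpace ℝ (Fin n) → EuclideanSpace ℝ (Fin m) → EuclideanSpace ℝ (Fin n))
    (U : Set (EuclideanSpace ℝ (Fin m)))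
    (ψ : Fin I → ℝ → EuclideanSpace ℝ (Fin n) → ℝ) (η μ : ℝ) (γ σ : ℕ → ℝ) : Prop where
  /-- `μ` bounds `|∇ₓψⁱ||f| + |∂ₜψⁱ| + 1` for `t ∈ [0,T]`, `u ∈ U`, `x ∈ C(t) + Bₙ`. -/
  μ_bound : ∀ t ∈ Icc 0 T, ∀ u ∈ U, ∀ c ∈ movingSet ψ t, ∀ x, ‖x - c‖ ≤ 1 → ∀ i,
    ‖gradient (ψ i t) x‖ * ‖f t x u‖ + |derivWithin (fun s => ψ i s x) (Icc 0 T) t| + 1 ≤ μ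
  σ_antitone : Antitone σ
  σ_tendsto : Tendsto σ atTop (𝓝 0)
  γ_pos : ∀ k, 0 < γ k
  γ_monotone : Monotone γ
  γ_tendsto : Tendsto γ atTop atTop
  subset_interior : ∀ k, ∀ t ∈ Icc 0 T,
    movingSet ψ t ⊆ interior (enlargedSet ψ μ η (γ k) (σ k) t)

/-- `u` is a (Lebesgue) measurable function on `[0,T]` with `u(t) ∈ U` for a.e. `t`. -/
def IsControl {m : ℕ} (T : ℝ) (U : Set (EuclideanSpace ℝ (Fin m)))
    (u : ℝ → EuclideanSpace ℝ (Fin m)) : Prop :=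
  AEMeasurable u (volume.restrict (Icc 0 T)) ∧ ∀ᵐ t ∂(volume.restrict (Icc 0 T)), u t ∈ U

/-- `x` is an absolutely continuous solution on `[0,T]` of
`x'(t) = f(t,x,u) - ∑ᵢ γ exp(γ (ψⁱ(t,x) - σ)) ∇ₓψⁱ(t,x)`, `x(0) = b`. -/
def IsPenaltySolution {n m I : ℕ} (T : ℝ)
    (f : ℝ → EuclideanSpace ℝ (Fin n) → EuclideanSpace ℝ (Fin m) → EuclideanSpace ℝ (Fin n))
    (ψ : Fin I → ℝ → EuclideanSpace ℝ (Fin n) → ℝ) (γ σ : ℝ) (b : EuclideanSpace ℝ (Fin n))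
    (u : ℝ → EuclideanSpace ℝ (Fin m)) (x : ℝ → EuclideanSpace ℝ (Fin n)) : Prop :=
  AbsolutelyContinuousOnInterval x 0 T ∧ x 0 = b ∧
    ∀ᵐ t ∂(volume.restrict (Icc 0 T)), HasDerivAt x
      (f t (x t) (u t) -
        ∑ i, (γ * Real.exp (γ * (ψ i t (x t) - σ))) • gradient (ψ i t) (x t)) t

/-- `x` is an absolutely continuous solution on `[0,T]` of
`x'(t) ∈ f(t,x(t),u(t)) - N_{C(t)}(x(t))`, `x(0) = x₀`, for the given control `u`. -/
def IsSweepingSolution {n m I : ℕ} (T : ℝ)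
    (f : ℝ → EuclideanSpace ℝ (Fin n) → EuclideanSpace ℝ (Fin m) → EuclideanSpace ℝ (Fin n))
    (ψ : Fin I → ℝ → EuclideanSpace ℝ (Fin n) → ℝ) (x₀ : EuclideanSpace ℝ (Fin n))
    (u : ℝ → EuclideanSpace ℝ (Fin m)) (x : ℝ → EuclideanSpace ℝ (Fin n)) : Prop :=
  AbsolutelyContinuousOnInterval x 0 T ∧ x 0 = x₀ ∧
    ∀ᵐ t ∂(volume.restrict (Icc 0 T)),
      ∃ w ∈ limitingNormalCone (movingSet ψ t) (x t), HasDerivAt x (f t (x t) (u t) - w) t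

/-- `x` is an absolutely continuous solution on `[0,T]` of the differential inclusion
`x'(t) ∈ f(t,x(t),U) - N_{C(t)}(x(t))`, `x(0) = x₀`. -/
def IsSweepingInclusionSolution {n m I : ℕ} (T : ℝ)
    (f : ℝ → EuclideanSpace ℝ (Fin n) → EuclideanSpace ℝ (Fin m) → EuclideanSpace ℝ (Fin n))
    (U : Set (EuclideanSpace ℝ (Fin m)))
    (ψ : Fin I → ℝ → EuclideanSpace ℝ (Fin n) → ℝ) (x₀ : EuclideanSpace ℝ (Fin n))
    (x : ℝ → EuclideanSpace ℝ (Fin n)) : Prop :=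
  AbsolutelyContinuousOnInterval x 0 T ∧ x 0 = x₀ ∧
    ∀ᵐ t ∂(volume.restrict (Icc 0 T)),
      ∃ a ∈ U, ∃ w ∈ limitingNormalCone (movingSet ψ t) (x t), HasDerivAt x (f t (x t) a - w) t

/-!
# Penalization of a controlled sweeping process

Solutions of the penalized equation have a limit because the enlarged sets `Cᵏ(t)` are invariant for
large `k`. The gradients of the nearly active constraints form acute angles, so at a point where
`ψⁱ - σₖ` exceeds the penalty level the `i`-th penalty term alone makes `ψⁱ` decrease, and no other
term counteracts it (`PenaltyParameters.le_level_of_penaltyField`). This needs an error bound, by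
which points where all `ψⁱ` are small are close to `C(t)`; it follows by minimizing the total
violation plus a multiple of a distance (`exists_mem_movingSet_norm_sub_le`). In the enlarged sets
the multipliers `γₖ exp (γₖ (ψⁱ - σₖ))` are at most `μ / η²`, so the solutions are uniformly
Lipschitz. The Arzelà–Ascoli theorem is applied to the solutions together with the primitives of
their drifts and multipliers. A derivative of a limit of primitives lies in any closed convex set
that the integrands approach (`hasDerivAt_mem_of_tendsto_integral`). This replaces weak compactness:
the limit velocity is a point of `f(t, x, U)` minus a nonnegative combination of gradients of active
constraints, which is a normal vector (`exists_velocity_of_tendsto`).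

The sets `C(t)` are uniformly prox-regular: tilting the chord from `x` to `z` inwards by a multiple
of `‖z - x‖²` makes it a direction into `C(t)`, so limiting normals `w` at `x` are exactly the
vectors with `⟪w, z - x⟫ ≤ c ‖w‖ ‖z - x‖²` on `C(t)`, with `c` independent of `t`
(`exists_mem_limitingNormalCone_iff`). Hence solutions for a given control are unique, by Gronwall's
inequality (`IsSweepingSolution.eqOn`), and for a fixed control all subsequences of penalized
solutions have the same limit. The same characterization makes the graph of the normal cones closed,
so a solution of the differential inclusion admits a measurable control, chosen by a Borel selector
of a closed relation with compact fibres (`exists_measurable_selector`). The penalized equations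
with this control are solvable for large `k` as Carathéodory equations cut off outside a ball
(`PenaltyParameters.exists_isPenaltySolution`).
-/


/-! ### Absolutely continuous functions -/

section AbsolutelyContinuous

variable {X Y Z F : Type*} [PseudoMetricSpace X] [PseudoMetricSpace Y] [PseudoMetricSpace Z]
  [NormedAddCommGroup F]

/-- A function whose increments are controlled by those of two absolutely continuous functions is
absolutely continuous. -/
theorem AbsolutelyContinuousOnInterval.of_dist_le {f : ℝ → X} {g : ℝ → Y} {h : ℝ → Z} {a b K : ℝ}
    (hf : AbsolutelyContinuousOnInterval f a b) (hg : AbsolutelyContinuousOnInterval g a b)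
    (hh : ∀ s ∈ uIcc a b, ∀ t ∈ uIcc a b,
      dist (h s) (h t) ≤ K * (dist (f s) (f t) + dist (g s) (g t))) :
    AbsolutelyContinuousOnInterval h a b := by
  have key := (Tendsto.add hf hg).const_mul K
  simp only [add_zero, mul_zero] at key
  refine squeeze_zero' (Eventually.of_forall fun _ => Finset.sum_nonneg fun _ _ => dist_nonneg)
    ?_ key
  rw [eventually_inf_principal]
  refine Eventually.of_forall fun J hJ => ?_
  rw [← Finset.sum_add_distrib, Finset.mul_sum]
  exact Finset.sum_le_sum fun i hi => hh _ (hJ.1 i hi).1 _ (hJ.1 i hi).2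

theorem AbsolutelyContinuousOnInterval.of_dist_le_single {f : ℝ → X} {h : ℝ → Z} {a b K : ℝ}
    (hf : AbsolutelyContinuousOnInterval f a b)
    (hh : ∀ s ∈ uIcc a b, ∀ t ∈ uIcc a b, dist (h s) (h t) ≤ K * dist (f s) (f t)) :
    AbsolutelyContinuousOnInterval h a b :=
  hf.of_dist_le (g := f) (K := K / 2) hf fun s hs t ht => (hh s hs t ht).trans_eq (by ring)

theorem AbsolutelyContinuousOnInterval.norm {f : ℝ → F} {a b : ℝ}
    (hf : AbsolutelyContinuousOnInterval f a b) :
    AbsolutelyContinuousOnInterval (fun t => ‖f t‖) a b :=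
  hf.of_dist_le_single (K := 1) fun s _ t _ => by
    rw [one_mul, dist_eq_norm (f s)]; exact abs_norm_sub_norm_le _ _

theorem absolutelyContinuousOnInterval_id (a b : ℝ) :
    AbsolutelyContinuousOnInterval (fun t : ℝ => t) a b :=
  (LipschitzWith.id.lipschitzOnWith).absolutelyContinuousOnInterval

/-- The increment of an absolutely continuous function is the integral of its derivative; an upper
bound of the derivative by an integrable function bounds the increment. -/
theorem AbsolutelyContinuousOnInterval.sub_le_integral {h κ : ℝ → ℝ} {a b : ℝ} (hab : a ≤ b)
    (hh : AbsolutelyContinuousOnInterval h a b) (hκ : IntervalIntegrable κ volume a b)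
    (hd : ∀ᵐ s, s ∈ Ioo a b → ∃ d, HasDerivAt h d s ∧ d ≤ κ s) :
    h b - h a ≤ ∫ s in a..b, κ s := by
  rw [← hh.integral_deriv_eq_sub]
  refine intervalIntegral.integral_mono_ae_restrict hab hh.intervalIntegrable_deriv hκ ?_
  rw [← restrict_Ioo_eq_restrict_Icc]
  rw [EventuallyLE, ae_restrict_iff' measurableSet_Ioo]
  filter_upwards [hd] with s hs hs'
  obtain ⟨d, h1, h2⟩ := hs hs'
  rwa [h1.deriv]

/-- Barrier principle: a function that does not increase while it is above a level never rises
above that level. -/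
theorem AbsolutelyContinuousOnInterval.le_of_deriv_nonpos_above {h : ℝ → ℝ} {a b ℓ : ℝ}
    (hab : a ≤ b) (hh : AbsolutelyContinuousOnInterval h a b) (ha : h a ≤ ℓ)
    (hd : ∀ᵐ s, s ∈ Ioo a b → ℓ < h s → ∃ d, HasDerivAt h d s ∧ d ≤ 0) : h b ≤ ℓ := by
  by_contra! hb
  have hcont : ContinuousOn h (Icc a b) := by simpa [uIcc_of_le hab] using hh.continuousOn
  -- the last time at which `h` is at most `ℓ`
  have hcl : IsCompact (Icc a b ∩ h ⁻¹' Iic ℓ) :=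
    isCompact_Icc.of_isClosed_subset (hcont.preimage_isClosed_of_isClosed isClosed_Icc isClosed_Iic)
      inter_subset_left
  obtain ⟨s, ⟨hs, hsℓ⟩, hmax⟩ := hcl.exists_isGreatest ⟨a, ⟨le_rfl, hab⟩, ha⟩
  have hac : AbsolutelyContinuousOnInterval h s b :=
    hh.mono (by rw [uIcc_of_le hab, uIcc_of_le hs.2]; exact Icc_subset_Icc hs.1 le_rfl)
  have := hac.sub_le_integral (κ := fun _ => 0) hs.2 (by simp) (by
    filter_upwards [hd] with t ht hst
    refine ht ⟨hs.1.trans_lt hst.1, hst.2⟩ ?_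
    by_contra! hle
    exact absurd (hmax ⟨⟨hs.1.trans hst.1.le, hst.2.le⟩, hle⟩) (not_le.2 hst.1))
  simp only [intervalIntegral.integral_zero] at this
  have : h s ≤ ℓ := hsℓ
  linarith

/-- Gronwall's inequality with an integrable rate and vanishing initial value. -/
theorem AbsolutelyContinuousOnInterval.eq_zero_of_deriv_le_mul {g κ : ℝ → ℝ} {T : ℝ} (hT : 0 ≤ T)
    (hg : AbsolutelyContinuousOnInterval g 0 T) (hκ : IntervalIntegrable κ volume 0 T)
    (hκ0 : ∀ t, 0 ≤ κ t) (hg0 : g 0 = 0) (hgn : ∀ t ∈ Icc 0 T, 0 ≤ g t)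
    (hd : ∀ᵐ s, s ∈ Ioo 0 T → ∃ d, HasDerivAt g d s ∧ d ≤ κ s * g s) :
    ∀ t ∈ Icc 0 T, g t = 0 := by
  have hcont : ContinuousOn g (Icc 0 T) := by simpa [uIcc_of_le hT] using hg.continuousOn
  refine IsClosed.Icc_subset_of_forall_exists_gt (s := {t | g t = 0}) ?_ hg0 ?_
  · rw [inter_comm]
    exact hcont.preimage_isClosed_of_isClosed isClosed_Icc isClosed_singleton
  rintro t ⟨ht0, ht⟩ y hy
  -- on a short interval `∫ κ ≤ 1/2`, so the maximum of `g` there is at most half of itself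
  have hcK : ContinuousOn (fun s => ∫ x in (0:ℝ)..s, κ x) (Icc 0 T) := by
    have := intervalIntegral.continuousOn_primitive_interval' hκ (left_mem_uIcc)
    rwa [uIcc_of_le hT] at this
  have hev : ∀ᶠ s in 𝓝[Icc 0 T] t, (∫ x in (0:ℝ)..s, κ x) < (∫ x in (0:ℝ)..t, κ x) + 1 / 2 :=
    (hcK t (Ico_subset_Icc_self ht)).eventually (gt_mem_nhds (by linarith))
  have hev' : ∀ᶠ s in 𝓝[>] t, (∫ x in (0:ℝ)..s, κ x) < (∫ x in (0:ℝ)..t, κ x) + 1 / 2 := by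
    have : 𝓝[>] t ≤ 𝓝[Icc 0 T] t := by
      rw [← nhdsWithin_Ioc_eq_nhdsGT ht.2]
      exact nhdsWithin_mono _ fun s hs => ⟨ht.1.trans hs.1.le, hs.2⟩
    exact this hev
  obtain ⟨s, hs1, hs2⟩ := (hev'.and (Ioc_mem_nhdsGT (lt_min ht.2 hy))).exists
  have hst : t ≤ s := hs2.1.le
  have hsT : s ≤ T := hs2.2.trans (min_le_left _ _)
  have hsub : ∀ {p q : ℝ}, t ≤ p → p ≤ q → q ≤ s → IntervalIntegrable κ volume p q :=
    fun hp hpq hq => hκ.mono_set (by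
      rw [uIcc_of_le hT, uIcc_of_le hpq]
      exact Icc_subset_Icc (ht.1.trans hp) (hq.trans hsT))
  obtain ⟨p, hp, hpmax⟩ := isCompact_Icc.exists_isMaxOn ⟨t, ⟨le_rfl, hst⟩⟩
    (hcont.mono (Icc_subset_Icc ht.1 hsT))
  have hgp : 0 ≤ g p := hgn p ⟨ht.1.trans hp.1, hp.2.trans hsT⟩
  have hle := (hg.mono (c := t) (d := p) (by
      rw [uIcc_of_le hT, uIcc_of_le hp.1]
      exact Icc_subset_Icc ht.1 (hp.2.trans hsT))).sub_le_integral
    (κ := fun x => κ x * g p) hp.1 ((hsub le_rfl hp.1 hp.2).mul_const _) (by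
      filter_upwards [hd] with x hx hxp
      obtain ⟨d, h1, h2⟩ := hx ⟨ht.1.trans_lt hxp.1, hxp.2.trans_le (hp.2.trans hsT)⟩
      exact ⟨d, h1, h2.trans (mul_le_mul_of_nonneg_left
        (hpmax ⟨hxp.1.le, hxp.2.le.trans hp.2⟩) (hκ0 x))⟩)
  rw [intervalIntegral.integral_mul_const] at hle
  have h1 : (∫ x in t..p, κ x) ≤ 1 / 2 := by
    have e1 : (∫ x in (0:ℝ)..t, κ x) + ∫ x in t..s, κ x = ∫ x in (0:ℝ)..s, κ x :=
      intervalIntegral.integral_add_adjacent_intervals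
        (hκ.mono_set (by rw [uIcc_of_le hT, uIcc_of_le ht.1]; exact Icc_subset_Icc le_rfl ht.2.le))
        (hsub le_rfl hst le_rfl)
    have e2 : (∫ x in t..p, κ x) + ∫ x in p..s, κ x = ∫ x in t..s, κ x :=
      intervalIntegral.integral_add_adjacent_intervals (hsub le_rfl hp.1 hp.2)
        (hsub hp.1 hp.2 le_rfl)
    have e3 : 0 ≤ ∫ x in p..s, κ x := intervalIntegral.integral_nonneg hp.2 fun x _ => hκ0 x
    linarith
  have ht0' : g t = 0 := ht0
  have hp0 : g p = 0 := by nlinarith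
  refine ⟨s, ?_, hs2.1, hs2.2.trans (min_le_right _ _)⟩
  exact le_antisymm ((hpmax ⟨hst, le_rfl⟩).trans_eq hp0) (hgn s ⟨ht.1.trans hst, hsT⟩)

variable [NormedSpace ℝ F]

/-- A primitive of a bounded function is Lipschitz. -/
theorem lipschitzOnWith_primitive {g : ℝ → F} {T B : ℝ} (hT : 0 ≤ T)
    (hg : IntegrableOn g (Icc 0 T)) (hB : ∀ᵐ s ∂volume.restrict (Icc 0 T), ‖g s‖ ≤ B) :
    LipschitzOnWith B.toNNReal (fun t => ∫ s in (0:ℝ)..t, g s) (Icc 0 T) := by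
  have hint : ∀ {a b : ℝ}, a ∈ Icc 0 T → b ∈ Icc 0 T → IntervalIntegrable g volume a b :=
    fun {a b} ha hb => by
      refine IntegrableOn.intervalIntegrable (hg.mono_set ?_)
      exact uIcc_subset_Icc ha hb
  refine LipschitzOnWith.of_dist_le_mul fun x hx y hy => ?_
  have h0 : (0:ℝ) ∈ Icc 0 T := ⟨le_rfl, hT⟩
  rw [dist_eq_norm, intervalIntegral.integral_interval_sub_left (hint h0 hx) (hint h0 hy),
    Real.dist_eq]
  rw [ae_restrict_iff' measurableSet_Icc] at hB
  refine (intervalIntegral.norm_integral_le_of_norm_le_const_ae (C := B) ?_).trans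
    (mul_le_mul_of_nonneg_right (Real.le_coe_toNNReal B) (abs_nonneg _))
  filter_upwards [hB] with s hs hs'
  exact hs (uIcc_subset_Icc hy hx (uIoc_subset_uIcc hs'))

/-- The fundamental theorem of calculus for an absolutely continuous function with bounded
derivative. -/
theorem AbsolutelyContinuousOnInterval.eq_add_integral [CompleteSpace F] {x g : ℝ → F} {T B : ℝ}
    (hT : 0 ≤ T) (hx : AbsolutelyContinuousOnInterval x 0 T) (hg : IntegrableOn g (Icc 0 T))
    (hB : ∀ᵐ s ∂volume.restrict (Icc 0 T), ‖g s‖ ≤ B)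
    (hd : ∀ᵐ s ∂volume.restrict (Icc 0 T), HasDerivAt x (g s) s) :
    ∀ t ∈ Icc 0 T, x t = x 0 + ∫ s in (0:ℝ)..t, g s := by
  have hac : AbsolutelyContinuousOnInterval (fun t => ∫ s in (0:ℝ)..t, g s) 0 T :=
    LipschitzOnWith.absolutelyContinuousOnInterval (by
      rw [uIcc_of_le hT]; exact lipschitzOnWith_primitive hT hg hB)
  have hii : IntervalIntegrable g volume 0 T :=
    IntegrableOn.intervalIntegrable (by rwa [uIcc_of_le hT])
  rw [ae_restrict_iff' measurableSet_Icc] at hd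
  obtain ⟨C, hC⟩ := (hx.sub hac).const_of_ae_hasDerivAt_zero (by
    filter_upwards [hd, hii.ae_hasDerivAt_integral] with s h1 h2 hs
    have h3 := h1 (by rwa [uIcc_of_le hT] at hs)
    have h4 := h2 hs 0 left_mem_uIcc
    simpa using h3.sub h4)
  intro t ht
  have e0 := hC 0 left_mem_uIcc
  have e1 := hC t (by rwa [uIcc_of_le hT])
  simp only [Pi.sub_apply, intervalIntegral.integral_same, sub_zero] at e0 e1
  rw [e0, ← e1]; abel

/-- The norm of the derivative of an absolutely continuous curve in a Euclidean space is
integrable. -/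
theorem AbsolutelyContinuousOnInterval.intervalIntegrable_norm_deriv {n : ℕ}
    {x : ℝ → EuclideanSpace ℝ (Fin n)} {a b : ℝ} (hx : AbsolutelyContinuousOnInterval x a b)
    (hd : ∀ᵐ s, s ∈ uIcc a b → DifferentiableAt ℝ x s) :
    IntervalIntegrable (fun s => ‖deriv x s‖) volume a b := by
  have hco : ∀ i, AbsolutelyContinuousOnInterval (fun t => x t i) a b := fun i =>
    hx.of_dist_le_single (K := 1) fun s _ t _ => by
      rw [one_mul, dist_eq_norm, dist_eq_norm]
      simpa using PiLp.norm_apply_le (x s - x t) i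
  have hsum : IntervalIntegrable (fun s => ∑ i, ‖deriv (fun t => x t i) s‖) volume a b := by
    have := IntervalIntegrable.sum (μ := volume) (a := a) (b := b) Finset.univ
      (f := fun i s => ‖deriv (fun t => x t i) s‖)
      fun i _ => (hco i).intervalIntegrable_deriv.norm
    simpa only [Finset.sum_fn] using this
  refine hsum.mono_fun' ((measurable_deriv x).norm.aestronglyMeasurable) ?_
  rw [EventuallyLE, ae_restrict_iff' measurableSet_uIoc]
  filter_upwards [hd] with s hs hs'
  have h1 := (hs (uIoc_subset_uIcc hs')).hasDerivAt
  have h2 : ∀ i, HasDerivAt (fun t => x t i) (deriv x s i) s := fun i =>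
    ((EuclideanSpace.proj i : EuclideanSpace ℝ (Fin n) →L[ℝ] ℝ).hasFDerivAt).comp_hasDerivAt s h1
  simp only [fun i => (h2 i).deriv, norm_norm]
  have := EuclideanSpace.norm_eq (deriv x s)
  rw [this]
  refine Real.sqrt_le_iff.2 ⟨Finset.sum_nonneg fun _ _ => norm_nonneg _, ?_⟩
  exact Finset.sum_sq_le_sq_sum_of_nonneg fun _ _ => norm_nonneg _

end AbsolutelyContinuous

/-! ### Measurable selection -/

/-- A closed relation with values in a compact metric space has a Borel selector: parametrize the
compact space by the Cantor set and take the least parameter in each fibre; the projections of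
closed sets along the compact Cantor set are closed, so this is a Borel function. -/
theorem exists_measurable_selector {X Y : Type*} [TopologicalSpace X] [MeasurableSpace X]
    [OpensMeasurableSpace X] [MetricSpace Y] [MeasurableSpace Y] [BorelSpace Y]
    {K : Set (X × Y)} (hK : IsClosed K) {U : Set Y} (hU : IsCompact U) (hne : U.Nonempty)
    (hKU : ∀ p ∈ K, p.2 ∈ U) :
    ∃ s : X → Y, Measurable s ∧ (∀ x, s x ∈ U) ∧ ∀ x, (∃ y, (x, y) ∈ K) → (x, s x) ∈ K := by
  classical
  have : CompactSpace U := isCompact_iff_compactSpace.1 hU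
  have : Nonempty U := hne.to_subtype
  have : CompactSpace cantorSet := isCompact_iff_compactSpace.1 isCompact_cantorSet
  obtain ⟨φ₀, hφ₀, hφ₀s⟩ := exists_nat_bool_continuous_surjective_of_compact U
  set φ : cantorSet → U := φ₀ ∘ cantorSetHomeomorphNatToBool
  have hφ : Continuous φ := hφ₀.comp cantorSetHomeomorphNatToBool.continuous
  have hφs : Function.Surjective φ := hφ₀s.comp cantorSetHomeomorphNatToBool.surjective
  set K' : Set (X × cantorSet) := {p | (p.1, (φ p.2 : Y)) ∈ K}
  have hK' : IsClosed K' := hK.preimage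
    (continuous_fst.prodMk (continuous_subtype_val.comp (hφ.comp continuous_snd)))
  set S : Set X := Prod.fst '' K'
  have hS : IsClosed S := isClosedMap_fst_of_compactSpace _ hK'
  have hex : ∀ x, ∃ c : cantorSet, (x ∈ S → IsLeast {c | (x, c) ∈ K'} c) ∧
      (x ∉ S → c = ⟨0, zero_mem_cantorSet⟩) := by
    intro x
    by_cases hx : x ∈ S
    · have hcl : IsClosed {c | (x, c) ∈ K'} := hK'.preimage (Continuous.prodMk_right x)
      obtain ⟨⟨x', c⟩, hc, rfl⟩ := hx
      obtain ⟨d, hd⟩ := hcl.isCompact.exists_isLeast ⟨c, hc⟩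
      exact ⟨d, fun _ => hd, fun h => absurd ⟨_, hc, rfl⟩ h⟩
    · exact ⟨_, fun h => absurd h hx, fun _ => rfl⟩
  choose c hcS hcS' using hex
  have hc : Measurable c := by
    suffices h : Measurable fun x => (c x : ℝ) from h.subtype_mk
    refine measurable_of_Iic fun a => ?_
    have hle : {x | (c x : ℝ) ≤ a} =
        Prod.fst '' (K' ∩ {p | (p.2 : ℝ) ≤ a}) ∪ (Sᶜ ∩ {_x | (0 : ℝ) ≤ a}) := by
      ext x
      by_cases hx : x ∈ S
      · simp only [mem_ofPred_eq, mem_union, mem_inter_iff, mem_compl_iff, hx, not_true_eq_false,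
          false_and, or_false]
        constructor
        · exact fun h => ⟨(x, c x), ⟨(hcS x hx).1, h⟩, rfl⟩
        · rintro ⟨⟨x', d⟩, ⟨hd, hda⟩, rfl⟩
          exact (Subtype.coe_le_coe.2 ((hcS x' hx).2 hd)).trans hda
      · have h1 : x ∉ Prod.fst '' (K' ∩ {p | (p.2 : ℝ) ≤ a}) :=
          fun h => hx (image_mono inter_subset_left h)
        simp only [mem_ofPred_eq, mem_union, h1, false_or, mem_inter_iff, mem_compl_iff, hx,
          not_false_eq_true, true_and, hcS' x hx]
    change MeasurableSet {x | (c x : ℝ) ≤ a}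
    rw [hle]
    refine MeasurableSet.union ?_ (hS.measurableSet.compl.inter (MeasurableSet.const _))
    refine (isClosedMap_fst_of_compactSpace _ (hK'.inter ?_)).measurableSet
    exact isClosed_le (continuous_subtype_val.comp continuous_snd) continuous_const
  refine ⟨fun x => φ (c x), measurable_subtype_coe.comp (hφ.measurable.comp hc),
    fun x => (φ (c x)).2, fun x hx => ?_⟩
  obtain ⟨y, hy⟩ := hx
  obtain ⟨d, hd⟩ := hφs ⟨y, hKU _ hy⟩
  have : x ∈ S := ⟨(x, d), by simpa [K', hd] using hy, rfl⟩
  exact (hcS x this).1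

/-! ### Carathéodory differential equations -/

section Caratheodory

variable {F : Type*} [NormedAddCommGroup F] [NormedSpace ℝ F] [CompleteSpace F]

/-- The Picard operator of `x' = g(t, x)`, `x(0) = b`, on continuous curves over `[0,T]`.
Under the integral a curve is extended to `ℝ` by its end values. -/
noncomputable def picardOperator {T : ℝ} (hT : 0 ≤ T) (g : ℝ → F → F) (b : F)
    (hc : ∀ x : ℝ → F, Continuous x → IntegrableOn (fun s => g s (x s)) (Icc 0 T))
    (x : C(Icc 0 T, F)) : C(Icc 0 T, F) where
  toFun t := b + ∫ s in (0:ℝ)..t, g s (x (projIcc 0 T hT s))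
  continuous_toFun := by
    have h1 := hc (fun s => x (projIcc 0 T hT s)) (x.continuous.comp continuous_projIcc)
    have := intervalIntegral.continuousOn_primitive_interval (μ := volume) (a := 0) (b := T)
      (f := fun s => g s (x (projIcc 0 T hT s))) (by rwa [uIcc_of_le hT])
    rw [uIcc_of_le hT] at this
    exact continuous_const.add (continuousOn_iff_continuous_domRestrict.1 this)

/-- Existence for Carathéodory equations with a bounded right-hand side that is Lipschitz in the
state: some iterate of the Picard operator is a contraction. -/
theorem exists_caratheodory_solution {T L B : ℝ} (hT : 0 ≤ T) (hL : 0 ≤ L) {g : ℝ → F → F}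
    (b : F) (hmeas : ∀ x : ℝ → F, Continuous x →
      AEStronglyMeasurable (fun s => g s (x s)) (volume.restrict (Icc 0 T)))
    (hB : ∀ s ∈ Icc 0 T, ∀ x, ‖g s x‖ ≤ B)
    (hlip : ∀ s ∈ Icc 0 T, ∀ x y, ‖g s x - g s y‖ ≤ L * ‖x - y‖) :
    ∃ x : ℝ → F, AbsolutelyContinuousOnInterval x 0 T ∧ x 0 = b ∧
      ∀ᵐ t ∂volume.restrict (Icc 0 T), HasDerivAt x (g t (x t)) t := by
  have hbd : ∀ x : ℝ → F, ∀ᵐ s ∂volume.restrict (Icc 0 T), ‖g s (x s)‖ ≤ B := fun x => by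
    filter_upwards [ae_restrict_mem measurableSet_Icc] with s hs using hB s hs _
  have hc : ∀ x : ℝ → F, Continuous x → IntegrableOn (fun s => g s (x s)) (Icc 0 T) :=
    fun x hx => Integrable.of_bound (hmeas x hx) B (hbd x)
  set Φ := picardOperator hT g b hc
  have hii : ∀ (x : C(Icc 0 T, F)) (t : Icc (0:ℝ) T),
      IntervalIntegrable (fun s => g s (x (projIcc 0 T hT s))) volume 0 t := fun x t =>
    IntegrableOn.intervalIntegrable (by
      rw [uIcc_of_le t.2.1]
      exact (hc _ (x.continuous.comp continuous_projIcc)).mono_set (Icc_subset_Icc le_rfl t.2.2))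
  have hiter : ∀ (k : ℕ) (x y : C(Icc 0 T, F)) (t : Icc (0:ℝ) T),
      ‖(Φ^[k] x) t - (Φ^[k] y) t‖ ≤ (L * t) ^ k / k.factorial * dist x y := by
    intro k
    induction k with
    | zero =>
      intro x y t
      simpa [dist_eq_norm] using (x - y).norm_coe_le_norm t
    | succ k ih =>
      intro x y t
      rw [Function.iterate_succ_apply', Function.iterate_succ_apply']
      set X := Φ^[k] x
      set Y := Φ^[k] y
      change ‖(b + ∫ s in (0:ℝ)..t, g s (X (projIcc 0 T hT s))) -
        (b + ∫ s in (0:ℝ)..t, g s (Y (projIcc 0 T hT s)))‖ ≤ _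
      rw [add_sub_add_left_eq_sub, ← intervalIntegral.integral_sub (hii X t) (hii Y t)]
      have hint : (∫ s in (0:ℝ)..t, L * ((L * s) ^ k / k.factorial * dist x y)) =
          (L * t) ^ (k + 1) / (k + 1).factorial * dist x y := by
        have : ∀ s : ℝ, L * ((L * s) ^ k / k.factorial * dist x y) =
            (L ^ (k + 1) / k.factorial * dist x y) * s ^ k := fun s => by
          rw [mul_pow]; ring
        simp only [this, intervalIntegral.integral_const_mul, integral_pow]
        rw [Nat.factorial_succ, mul_pow]
        push_cast
        have : (k.factorial : ℝ) ≠ 0 := by positivity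
        field_simp
        simp
      rw [← hint]
      refine intervalIntegral.norm_integral_le_of_norm_le t.2.1 ?_
        (Continuous.intervalIntegrable (by fun_prop) _ _)
      refine Eventually.of_forall fun s hs => ?_
      have hsI : s ∈ Icc 0 T := ⟨hs.1.le, hs.2.trans t.2.2⟩
      refine (hlip s hsI _ _).trans (mul_le_mul_of_nonneg_left ?_ hL)
      have := ih x y ⟨s, hsI⟩
      rwa [projIcc_of_mem hT hsI]
  obtain ⟨k, hk⟩ : ∃ k : ℕ, (L * T) ^ k / k.factorial < 1 / 2 :=
    ((FloorSemiring.tendsto_pow_div_factorial_atTop (L * T)).eventually_lt_const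
      (by norm_num)).exists
  have hcontr : ContractingWith (1 / 2) Φ^[k] := by
    refine ⟨by norm_num, LipschitzWith.of_dist_le_mul fun x y => ?_⟩
    rw [ContinuousMap.dist_le (by positivity)]
    intro t
    rw [dist_eq_norm]
    refine (hiter k x y t).trans (mul_le_mul_of_nonneg_right ?_ dist_nonneg)
    have h1 : (L * t) ^ k / k.factorial ≤ (L * T) ^ k / k.factorial := by
      have := t.2.1
      have := t.2.2
      gcongr
    simpa using h1.trans hk.le
  set x₀ := hcontr.fixedPoint Φ^[k]
  have hfix : Φ x₀ = x₀ := hcontr.isFixedPt_fixedPoint_iterate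
  set x : ℝ → F := fun s => x₀ (projIcc 0 T hT s)
  have hx : Continuous x := x₀.continuous.comp continuous_projIcc
  have heq : EqOn x (fun t => b + ∫ s in (0:ℝ)..t, g s (x s)) (Icc 0 T) := fun t ht => by
    change x₀ _ = _
    rw [projIcc_of_mem hT ht]
    exact (DFunLike.congr_fun hfix ⟨t, ht⟩).symm
  have hlipx : LipschitzOnWith B.toNNReal x (Icc 0 T) := by
    have := lipschitzOnWith_primitive hT (hc x hx) (hbd x)
    refine LipschitzOnWith.of_dist_le_mul fun s hs t ht => ?_
    rw [heq hs, heq ht, dist_add_left]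
    exact this.dist_le_mul s hs t ht
  refine ⟨x, LipschitzOnWith.absolutelyContinuousOnInterval (by rwa [uIcc_of_le hT]), ?_, ?_⟩
  · simpa using heq ⟨le_rfl, hT⟩
  have hii' : IntervalIntegrable (fun s => g s (x s)) volume 0 T :=
    IntegrableOn.intervalIntegrable (by rw [uIcc_of_le hT]; exact hc x hx)
  rw [← restrict_Ioo_eq_restrict_Icc, ae_restrict_iff' measurableSet_Ioo]
  filter_upwards [hii'.ae_hasDerivAt_integral] with t ht htI
  have h1 := (ht (by rw [uIcc_of_le hT]; exact Ioo_subset_Icc_self htI) 0 left_mem_uIcc).const_add b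
  refine h1.congr_of_eventuallyEq ?_
  filter_upwards [Ioo_mem_nhds htI.1 htI.2] with s hs using heq (Ioo_subset_Icc_self hs)

end Caratheodory

/-! ### Limits of Lipschitz curves and of their derivatives -/

section Limits

open scoped NNReal

variable {F : Type*} [NormedAddCommGroup F]

/-- A sequence of uniformly Lipschitz curves with bounded initial points has a uniformly convergent
subsequence (Arzelà–Ascoli). -/
theorem exists_subseq_tendstoUniformlyOn_of_lipschitz [ProperSpace F] {T R : ℝ} (hT : 0 ≤ T)
    {K : ℝ≥0} {x : ℕ → ℝ → F} (hx : ∀ k, LipschitzOnWith K (x k) (Icc 0 T))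
    (h0 : ∀ k, ‖x k 0‖ ≤ R) :
    ∃ φ : ℕ → ℕ, StrictMono φ ∧ ∃ y : ℝ → F, LipschitzOnWith K y (Icc 0 T) ∧
      TendstoUniformlyOn (fun k => x (φ k)) y atTop (Icc 0 T) := by
  have h0m : (0:ℝ) ∈ Icc 0 T := ⟨le_rfl, hT⟩
  set X : ℕ → BoundedContinuousFunction (Icc (0:ℝ) T) F := fun k =>
    BoundedContinuousFunction.mkOfCompact
      ⟨fun t => x k t, continuousOn_iff_continuous_domRestrict.1 (hx k).continuousOn⟩
  set A : Set (BoundedContinuousFunction (Icc (0:ℝ) T) F) :=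
    {f | (∀ s t, dist (f s) (f t) ≤ K * dist s t) ∧
      ∀ t, f t ∈ Metric.closedBall (0:F) (R + K * T)}
  have hev : ∀ t : Icc (0:ℝ) T,
      Continuous fun f : BoundedContinuousFunction (Icc (0:ℝ) T) F => f t :=
    fun t => continuous_eval_const t
  have hAcl : IsClosed A := by
    have : A = (⋂ s, ⋂ t, {f | dist (f s) (f t) ≤ K * dist s t}) ∩
        ⋂ t, {f | f t ∈ Metric.closedBall (0:F) (R + K * T)} := by
      ext f; simp only [A, mem_ofPred_eq, mem_inter_iff, mem_iInter]
    rw [this]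
    refine IsClosed.inter (isClosed_iInter fun s => isClosed_iInter fun t => ?_)
      (isClosed_iInter fun t => Metric.isClosed_closedBall.preimage (hev t))
    exact isClosed_le ((hev s).dist (hev t)) continuous_const
  have hA : IsCompact A := by
    refine BoundedContinuousFunction.arzela_ascoli₂ _ (isCompact_closedBall (0:F) (R + K * T)) A
      hAcl (fun f t hf => hf.2 t) ?_
    refine (LipschitzWith.uniformEquicontinuous _ K fun f => ?_).equicontinuous
    exact LipschitzWith.of_dist_le_mul fun s t => f.2.1 s t
  have hXA : ∀ k, X k ∈ A := fun k => by
    refine ⟨fun s t => (hx k).dist_le_mul s s.2 t t.2, fun t => ?_⟩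
    rw [mem_closedBall_zero_iff]
    have h1 := (hx k).dist_le_mul t t.2 0 h0m
    rw [dist_eq_norm, Real.dist_eq, sub_zero, abs_of_nonneg t.2.1] at h1
    have h2 : ‖x k t‖ ≤ ‖x k 0‖ + ‖x k t - x k 0‖ := by
      simpa using norm_add_le (x k 0) (x k t - x k 0)
    have h3 : (K:ℝ) * t ≤ K * T := mul_le_mul_of_nonneg_left t.2.2 K.2
    change ‖x k t‖ ≤ _
    linarith [h0 k]
  obtain ⟨Y, hY, φ, hφ, hlim⟩ := hA.tendsto_subseq hXA
  refine ⟨φ, hφ, fun t => Y (projIcc 0 T hT t), ?_, ?_⟩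
  · refine LipschitzOnWith.of_dist_le_mul fun s hs t ht => ?_
    rw [projIcc_of_mem hT hs, projIcc_of_mem hT ht]
    exact hY.1 _ _
  · rw [BoundedContinuousFunction.tendsto_iff_tendstoUniformly] at hlim
    rw [Metric.tendstoUniformlyOn_iff]
    rw [Metric.tendstoUniformly_iff] at hlim
    intro ε hε
    filter_upwards [hlim ε hε] with k hk t ht
    have := hk ⟨t, ht⟩
    rw [projIcc_of_mem hT ht]
    exact this

/-- If primitives of `q k` converge, and near `t` the values of `q k` approach a closed convex set,
then the derivative at `t` of the limit belongs to this set. -/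
theorem hasDerivAt_mem_of_tendsto_integral [NormedSpace ℝ F] [CompleteSpace F] {T t : ℝ}
    (ht : t ∈ Ioo 0 T) {q : ℕ → ℝ → F} {Q : ℝ → F} {Q' : F} {K : Set F} (hKc : Convex ℝ K)
    (hKcl : IsClosed K) (hq : ∀ k, IntegrableOn (q k) (Icc 0 T))
    (hQ : ∀ s ∈ Icc 0 T, Tendsto (fun k => ∫ x in t..s, q k x) atTop (𝓝 (Q s - Q t)))
    (hd : HasDerivAt Q Q' t)
    (hnear : ∀ ε > 0, ∃ δ > 0, ∀ᶠ k in atTop, ∀ᵐ s, s ∈ Icc 0 T → |s - t| < δ →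
      q k s ∈ Metric.cthickening ε K) : Q' ∈ K := by
  rw [← hKcl.closure_eq, Metric.closure_eq_iInter_cthickening]
  refine mem_iInter₂.2 fun ε hε => ?_
  obtain ⟨δ, hδ, hk⟩ := hnear ε hε
  have hslope := (hasDerivAt_iff_tendsto_slope.1 hd).mono_left (nhdsGT_le_nhdsNE t)
  refine Metric.isClosed_cthickening.mem_of_tendsto hslope ?_
  filter_upwards [Ioo_mem_nhdsGT (lt_min ht.2 (lt_add_of_pos_right t hδ))] with s hs
  have hsT : s < T := hs.2.trans_le (min_le_left _ _)
  have hsδ : s < t + δ := hs.2.trans_le (min_le_right _ _)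
  have hlim := (hQ s ⟨(ht.1.trans hs.1).le, hsT.le⟩).const_smul (s - t)⁻¹
  refine Metric.isClosed_cthickening.mem_of_tendsto hlim ?_
  filter_upwards [hk] with k hk
  rw [← interval_average_eq, uIoc_of_le hs.1.le]
  have hsub : Ioc t s ⊆ Icc 0 T := fun r hr => ⟨(ht.1.trans hr.1).le, hr.2.trans hsT.le⟩
  refine (hKc.cthickening ε).set_average_mem Metric.isClosed_cthickening ?_ (by simp) ?_
    ((hq k).mono_set hsub)
  · simpa using hs.1
  · rw [ae_restrict_iff' measurableSet_Ioc]
    filter_upwards [hk] with r hr hrI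
    refine hr (hsub hrI) ?_
    rw [abs_of_pos (sub_pos.2 hrI.1)]
    linarith [hrI.2]

/-- A sequence of curves converges uniformly to `y` if every subsequence has a further subsequence
that does. -/
theorem tendstoUniformlyOn_of_subseq {s : Set ℝ} {x : ℕ → ℝ → F} {y : ℝ → F}
    (h : ∀ φ : ℕ → ℕ, StrictMono φ → ∃ θ : ℕ → ℕ, StrictMono θ ∧
      TendstoUniformlyOn (fun k => x (φ (θ k))) y atTop s) : TendstoUniformlyOn x y atTop s := by
  rw [Metric.tendstoUniformlyOn_iff]
  by_contra hcon
  simp only [not_forall] at hcon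
  obtain ⟨ε, hε, hcon⟩ := hcon
  obtain ⟨φ, hφ, hbad⟩ := extraction_of_frequently_atTop (not_eventually.1 hcon)
  obtain ⟨θ, -, hlim⟩ := h φ hφ
  obtain ⟨k, hk⟩ := (Metric.tendstoUniformlyOn_iff.1 hlim ε hε).exists
  exact hbad (θ k) hk

end Limits

/-! ### Regularity of the constraint functions -/

/-- A function decreases along a direction at any rate above its directional derivative. -/
theorem HasGradientAt.eventually_lt_add_mul {F : Type*} [NormedAddCommGroup F]
    [InnerProductSpace ℝ F] [CompleteSpace F] {g : F → ℝ} {v x d : F} {c : ℝ}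
    (hg : HasGradientAt g v x) (hc : inner ℝ v d < c) :
    ∀ᶠ s : ℝ in 𝓝[>] 0, g (x + s • d) < g x + s * c := by
  have hline : HasDerivAt (fun s : ℝ => x + s • d) d 0 := by
    simpa using ((hasDerivAt_id (0:ℝ)).smul_const d).const_add x
  have hg' : HasFDerivAt g (InnerProductSpace.toDual ℝ F v) (x + (0:ℝ) • d) := by
    simpa using hg.hasFDerivAt
  have h := hg'.comp_hasDerivAt (0:ℝ) hline
  rw [InnerProductSpace.toDual_apply_apply] at h
  have h1 := (hasDerivAt_iff_tendsto_slope.1 h).mono_left (nhdsGT_le_nhdsNE 0)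
  filter_upwards [h1.eventually_lt_const hc, self_mem_nhdsWithin] with s hs hs0
  have hs0' : (0:ℝ) < s := hs0
  rw [slope_def_field, div_lt_iff₀ (by simpa using hs0')] at hs
  simp only [Function.comp_apply, zero_smul, add_zero, sub_zero] at hs
  linarith

namespace MovingSetAssumptions

variable {n I : ℕ} {T r β η ρ : ℝ} {ψ : Fin I → ℝ → EuclideanSpace ℝ (Fin n) → ℝ}

theorem uniqueDiffOn (hT : 0 < T) :
    UniqueDiffOn ℝ (Icc 0 T ×ˢ (univ : Set (EuclideanSpace ℝ (Fin n)))) :=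
  (uniqueDiffOn_Icc hT).prod uniqueDiffOn_univ

theorem hasFDerivAt_slice (hψ : MovingSetAssumptions T ψ r β η ρ) (i : Fin I) {t : ℝ}
    (ht : t ∈ Icc 0 T) (x : EuclideanSpace ℝ (Fin n)) :
    HasFDerivAt (ψ i t)
      ((fderivWithin ℝ (fun p : ℝ × EuclideanSpace ℝ (Fin n) => ψ i p.1 p.2) (Icc 0 T ×ˢ univ)
        (t, x)).comp (ContinuousLinearMap.inr ℝ ℝ (EuclideanSpace ℝ (Fin n)))) x := by
  have h1 := ((hψ.contDiffOn i).differentiableOn (by simp) (t, x)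
    ⟨ht, mem_univ _⟩).hasFDerivWithinAt
  have h2 : HasFDerivAt (fun y : EuclideanSpace ℝ (Fin n) => (t, y))
      (ContinuousLinearMap.inr ℝ ℝ (EuclideanSpace ℝ (Fin n))) x :=
    hasFDerivAt_prodMk_right t x
  rw [← hasFDerivWithinAt_univ]
  exact h1.comp x h2.hasFDerivWithinAt fun y _ => ⟨ht, mem_univ _⟩

theorem hasGradientAt (hψ : MovingSetAssumptions T ψ r β η ρ) (i : Fin I) {t : ℝ}
    (ht : t ∈ Icc 0 T) (x : EuclideanSpace ℝ (Fin n)) :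
    HasGradientAt (ψ i t) (gradient (ψ i t) x) x :=
  (hψ.hasFDerivAt_slice i ht x).differentiableAt.hasGradientAt

theorem contDiffOn_gradient (hT : 0 < T) (hψ : MovingSetAssumptions T ψ r β η ρ) (i : Fin I) :
    ContDiffOn ℝ 1 (fun p : ℝ × EuclideanSpace ℝ (Fin n) => gradient (ψ i p.1) p.2)
      (Icc 0 T ×ˢ univ) := by
  have h1 : ContDiffOn ℝ 1 (fderivWithin ℝ (fun p : ℝ × EuclideanSpace ℝ (Fin n) => ψ i p.1 p.2)
      (Icc 0 T ×ˢ univ)) (Icc 0 T ×ˢ univ) :=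
    (hψ.contDiffOn i).fderivWithin (uniqueDiffOn hT) (by norm_num)
  have h2 := (InnerProductSpace.toDual ℝ (EuclideanSpace ℝ (Fin n))).symm.contDiff.comp_contDiffOn
    (h1.clm_comp (contDiffOn_const (c := ContinuousLinearMap.inr ℝ ℝ (EuclideanSpace ℝ (Fin n)))))
  refine h2.congr fun p hp => ?_
  have := (hψ.hasFDerivAt_slice i hp.1 p.2).fderiv
  rw [gradient, this]
  rfl

theorem continuousOn_joint (hψ : MovingSetAssumptions T ψ r β η ρ) (i : Fin I) :
    ContinuousOn (fun p : ℝ × EuclideanSpace ℝ (Fin n) => ψ i p.1 p.2) (Icc 0 T ×ˢ univ) :=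
  (hψ.contDiffOn i).continuousOn

theorem continuous_slice (hψ : MovingSetAssumptions T ψ r β η ρ) (i : Fin I) {t : ℝ}
    (ht : t ∈ Icc 0 T) : Continuous (ψ i t) :=
  continuous_iff_continuousAt.2 fun x => (hψ.hasFDerivAt_slice i ht x).continuousAt

theorem continuousOn_gradient (hT : 0 < T) (hψ : MovingSetAssumptions T ψ r β η ρ) (i : Fin I) :
    ContinuousOn (fun p : ℝ × EuclideanSpace ℝ (Fin n) => gradient (ψ i p.1) p.2)
      (Icc 0 T ×ˢ univ) :=
  (hψ.contDiffOn_gradient hT i).continuousOn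

/-- A `C¹` function on `[0,T] × ℝⁿ` is bounded and Lipschitz on bounded sets of `[0,T] × ℝⁿ`. -/
theorem _root_.ContDiffOn.exists_bound_lipschitz_strip {F : Type*} [NormedAddCommGroup F]
    [NormedSpace ℝ F] {g : ℝ × EuclideanSpace ℝ (Fin n) → F}
    (hg : ContDiffOn ℝ 1 g (Icc 0 T ×ˢ univ)) (R : ℝ) :
    ∃ K : ℝ, 0 ≤ K ∧ (∀ p ∈ Icc 0 T ×ˢ Metric.closedBall 0 R, ‖g p‖ ≤ K) ∧
      ∀ p ∈ Icc 0 T ×ˢ Metric.closedBall 0 R, ∀ q ∈ Icc 0 T ×ˢ Metric.closedBall 0 R,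
        dist (g p) (g q) ≤ K * dist p q := by
  have hcomp : IsCompact (Icc 0 T ×ˢ Metric.closedBall (0 : EuclideanSpace ℝ (Fin n)) R) :=
    isCompact_Icc.prod (isCompact_closedBall _ _)
  have hg' := hg.mono (prod_mono (le_refl (Icc 0 T))
    (subset_univ (Metric.closedBall (0 : EuclideanSpace ℝ (Fin n)) R)))
  obtain ⟨K, hK⟩ := hg'.exists_lipschitzOnWith (by simp)
    ((convex_Icc 0 T).prod (convex_closedBall _ _)) hcomp
  obtain ⟨B, hB⟩ := hcomp.exists_bound_of_continuousOn hg'.continuousOn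
  refine ⟨max K B, le_max_of_le_left K.2, fun p hp => (hB p hp).trans (le_max_right _ _),
    fun p hp q hq => (hK.dist_le_mul p hp q hq).trans ?_⟩
  exact mul_le_mul_of_nonneg_right (le_max_left _ _) dist_nonneg

/-- The gradients are bounded and Lipschitz on bounded sets, uniformly in time and index. -/
theorem exists_gradient_bound (hT : 0 < T) (hψ : MovingSetAssumptions T ψ r β η ρ) (R : ℝ) :
    ∃ G : ℝ, 0 < G ∧ ∀ t ∈ Icc 0 T, ∀ i,
      (∀ x ∈ Metric.closedBall 0 R, ‖gradient (ψ i t) x‖ ≤ G) ∧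
      ∀ x ∈ Metric.closedBall 0 R, ∀ y ∈ Metric.closedBall 0 R,
        ‖gradient (ψ i t) x - gradient (ψ i t) y‖ ≤ G * ‖x - y‖ := by
  choose K hK0 hKb hKl using fun i => (hψ.contDiffOn_gradient hT i).exists_bound_lipschitz_strip R
  have hle : ∀ i, K i ≤ 1 + ∑ j, K j := fun i =>
    (Finset.single_le_sum (fun j _ => hK0 j) (Finset.mem_univ i)).trans (by linarith)
  refine ⟨1 + ∑ i, K i, by have := Finset.sum_nonneg fun i (_ : i ∈ Finset.univ) => hK0 i; linarith,
    fun t ht i => ⟨fun x hx => (hKb i (t, x) ⟨ht, hx⟩).trans (hle i), fun x hx y hy => ?_⟩⟩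
  have := hKl i (t, x) ⟨ht, hx⟩ (t, y) ⟨ht, hy⟩
  rw [dist_eq_norm, Prod.dist_eq, dist_self, max_eq_right dist_nonneg, dist_eq_norm] at this
  exact this.trans (mul_le_mul_of_nonneg_right (hle i) (norm_nonneg _))

/-- The chain rule for a constraint function along a differentiable curve. -/
theorem hasDerivAt_comp_curve (hT : 0 < T) (hψ : MovingSetAssumptions T ψ r β η ρ) (i : Fin I)
    {x : ℝ → EuclideanSpace ℝ (Fin n)} {v : EuclideanSpace ℝ (Fin n)} {t : ℝ} (ht : t ∈ Ioo 0 T)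
    (hx : HasDerivAt x v t) :
    HasDerivAt (fun s => ψ i s (x s))
      (derivWithin (fun s => ψ i s (x t)) (Icc 0 T) t + inner ℝ (gradient (ψ i t) (x t)) v) t := by
  have htI := Ioo_subset_Icc_self ht
  set D := fderivWithin ℝ (fun p : ℝ × EuclideanSpace ℝ (Fin n) => ψ i p.1 p.2) (Icc 0 T ×ˢ univ)
    (t, x t) with hD
  have h1 : HasFDerivAt (fun p : ℝ × EuclideanSpace ℝ (Fin n) => ψ i p.1 p.2) D (t, x t) :=
    ((hψ.contDiffOn i).differentiableOn (by simp) (t, x t) ⟨htI, mem_univ _⟩).hasFDerivWithinAt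
      |>.hasFDerivAt (prod_mem_nhds (Icc_mem_nhds ht.1 ht.2) univ_mem)
  have h2 : HasDerivAt (fun s => ψ i s (x s)) (D (1, v)) t :=
    h1.comp_hasDerivAt (f := fun s => (s, x s)) t ((hasDerivAt_id' t).prodMk hx)
  have h3 : HasDerivAt (fun s => ψ i s (x t)) (D (1, 0)) t :=
    h1.comp_hasDerivAt (f := fun s => (s, x t)) t
      ((hasDerivAt_id' t).prodMk (hasDerivAt_const t (x t)))
  have h4 : derivWithin (fun s => ψ i s (x t)) (Icc 0 T) t = D (1, 0) :=
    h3.hasDerivWithinAt.derivWithin (uniqueDiffOn_Icc hT t htI)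
  have h5 : inner ℝ (gradient (ψ i t) (x t)) v = D (0, v) := by
    rw [gradient, (hψ.hasFDerivAt_slice i htI (x t)).fderiv, ← hD,
      InnerProductSpace.toDual_symm_apply]
    simp
  have h6 : D (1, v) = D (1, 0) + D (0, v) := by rw [← map_add]; simp
  rw [h4, h5, ← h6]
  exact h2

theorem absolutelyContinuousOnInterval_comp_curve (hT : 0 < T)
    (hψ : MovingSetAssumptions T ψ r β η ρ) (i : Fin I) {x : ℝ → EuclideanSpace ℝ (Fin n)}
    (hx : AbsolutelyContinuousOnInterval x 0 T) :
    AbsolutelyContinuousOnInterval (fun s => ψ i s (x s)) 0 T := by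
  obtain ⟨R, hR⟩ := hx.exists_bound
  obtain ⟨K, hK0, -, hK⟩ := ((hψ.contDiffOn i).of_le (by norm_num)).exists_bound_lipschitz_strip R
  refine (absolutelyContinuousOnInterval_id 0 T).of_dist_le (K := K) hx fun s hs t ht => ?_
  have h1 := hK (s, x s) ⟨by rwa [uIcc_of_le hT.le] at hs, by simpa using hR s hs⟩
    (t, x t) ⟨by rwa [uIcc_of_le hT.le] at ht, by simpa using hR t ht⟩
  refine h1.trans (mul_le_mul_of_nonneg_left ?_ hK0)
  rw [Prod.dist_eq]
  exact max_le_add_of_nonneg dist_nonneg dist_nonneg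

/-! ### Descent directions and normal cones -/

/-- Minus the sum of nearly active gradients is a descent direction for the constraints in the
sum, and does not increase the other nearly active ones, since the gradients form acute angles. -/
theorem inner_gradient_neg_sum_le (hψ : MovingSetAssumptions T ψ r β η ρ) {t : ℝ}
    (ht : t ∈ Icc 0 T) {x : EuclideanSpace ℝ (Fin n)} {J : Finset (Fin I)}
    (hJ : J ⊆ nearActive ψ β t x) {j : Fin I} (hj : j ∈ nearActive ψ β t x) :
    inner ℝ (gradient (ψ j t) x) (-∑ i ∈ J, gradient (ψ i t) x) ≤
      if j ∈ J then -‖gradient (ψ j t) x‖ ^ 2 else 0 := by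
  have hnn := fun i (hi : i ∈ J) => hψ.inner_nonneg t ht x j hj i (hJ hi)
  rw [inner_neg_right, inner_sum]
  split_ifs with h
  · have := Finset.single_le_sum hnn h
    rw [real_inner_self_eq_norm_sq] at this
    linarith
  · simpa using Finset.sum_nonneg hnn

theorem mem_nearActive_iff {t : ℝ} {x : EuclideanSpace ℝ (Fin n)} {i : Fin I} :
    i ∈ nearActive ψ β t x ↔ -(2 * β) < ψ i t x ∧ ψ i t x ≤ β := by
  simp [nearActive]

/-- Minus the sum of the gradients of the active constraints. -/
noncomputable def inwardDirection (ψ : Fin I → ℝ → EuclideanSpace ℝ (Fin n) → ℝ) (t : ℝ)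
    (x : EuclideanSpace ℝ (Fin n)) : EuclideanSpace ℝ (Fin n) :=
  open scoped Classical in -∑ i with ψ i t x = 0, gradient (ψ i t) x

theorem inner_gradient_inwardDirection (hψ : MovingSetAssumptions T ψ r β η ρ) {t : ℝ}
    (ht : t ∈ Icc 0 T) {x : EuclideanSpace ℝ (Fin n)} {j : Fin I} (hj : ψ j t x = 0) :
    inner ℝ (gradient (ψ j t) x) (inwardDirection ψ t x) ≤ -η ^ 2 := by
  classical
  have hβ := hψ.β_pos
  have hη := hψ.η_pos
  have hna : ∀ i, ψ i t x = 0 → i ∈ nearActive ψ β t x := fun i hi => by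
    rw [mem_nearActive_iff, hi]; constructor <;> linarith
  have h1 := hψ.inner_gradient_neg_sum_le ht (J := Finset.univ.filter fun i => ψ i t x = 0)
    (fun i hi => hna i (Finset.mem_filter.1 hi).2) (hna j hj)
  rw [if_pos (by simpa using hj)] at h1
  have h2 := hψ.gradient_bound t ht x j (by rw [hj]; constructor <;> linarith)
  have h3 : η ^ 2 ≤ ‖gradient (ψ j t) x‖ ^ 2 := by gcongr
  unfold inwardDirection
  convert h1.trans (neg_le_neg h3) using 1

/-- A direction along which all active constraints strictly decrease points into the set. -/
theorem eventually_lt_zero_of_inner_neg (hψ : MovingSetAssumptions T ψ r β η ρ) {t : ℝ}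
    (ht : t ∈ Icc 0 T) {x v : EuclideanSpace ℝ (Fin n)} (hx : x ∈ movingSet ψ t)
    (hv : ∀ j, ψ j t x = 0 → inner ℝ (gradient (ψ j t) x) v < 0) :
    ∀ᶠ s : ℝ in 𝓝[>] 0, ∀ j, ψ j t (x + s • v) < 0 := by
  rw [eventually_all]
  intro j
  rcases (hx j).lt_or_eq with hlt | heq
  · have hc : ContinuousAt (fun s : ℝ => ψ j t (x + s • v)) 0 := by
      have := (hψ.continuous_slice j ht).comp
        (continuous_const.add (continuous_id.smul (continuous_const (y := v))) : Continuous
          fun s : ℝ => x + s • v)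
      exact this.continuousAt
    refine (hc.eventually_lt_const ?_).filter_mono nhdsWithin_le_nhds
    simpa using hlt
  · filter_upwards [(hψ.hasGradientAt j ht x).eventually_lt_add_mul (hv j heq)] with s hs
    simpa [heq] using hs

theorem movingSet_subset_closure (hψ : MovingSetAssumptions T ψ r β η ρ) {t : ℝ}
    (ht : t ∈ Icc 0 T) : movingSet ψ t ⊆ closure {x | ∀ i, ψ i t x < 0} := by
  intro x hx
  have hη := hψ.η_pos
  have h1 := hψ.eventually_lt_zero_of_inner_neg ht hx (v := inwardDirection ψ t x) fun j hj =>
    (hψ.inner_gradient_inwardDirection ht hj).trans_lt (by simpa using pow_pos hη 2)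
  have h2 : Tendsto (fun s : ℝ => x + s • inwardDirection ψ t x) (𝓝[>] 0) (𝓝 x) := by
    have : Continuous fun s : ℝ => x + s • inwardDirection ψ t x := by fun_prop
    simpa using (this.tendsto 0).mono_left nhdsWithin_le_nhds
  exact mem_closure_of_tendsto h2 h1

theorem mem_closedBall_of_mem_movingSet (hψ : MovingSetAssumptions T ψ r β η ρ) {t : ℝ}
    (ht : t ∈ Icc 0 T) {x : EuclideanSpace ℝ (Fin n)} (hx : x ∈ movingSet ψ t) :
    x ∈ Metric.closedBall 0 r := by
  have := hψ.graph_in_ball t ht x hx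
  rw [mem_closedBall_zero_iff]
  exact abs_le_of_sq_le_sq (by nlinarith [sq_nonneg t]) hψ.r_pos.le |> (le_abs_self _).trans

theorem _root_.mem_regularNormalCone_of_quadratic {S : Set (EuclideanSpace ℝ (Fin n))}
    {x w : EuclideanSpace ℝ (Fin n)} {c : ℝ} (hx : x ∈ S)
    (hw : ∀ z ∈ S, inner ℝ w (z - x) ≤ c * ‖z - x‖ ^ 2) : w ∈ regularNormalCone S x := by
  refine ⟨hx, fun ε hε => ?_⟩
  have h1 : Tendsto (fun z : EuclideanSpace ℝ (Fin n) => c * ‖z - x‖) (𝓝[S] x) (𝓝 0) := by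
    have : Continuous fun z : EuclideanSpace ℝ (Fin n) => c * ‖z - x‖ := by fun_prop
    simpa using (this.tendsto x).mono_left nhdsWithin_le_nhds
  filter_upwards [h1.eventually_lt_const hε, self_mem_nhdsWithin] with z hz hzS
  refine (hw z hzS).trans ?_
  nlinarith [norm_nonneg (z - x)]

theorem _root_.regularNormalCone_subset_limitingNormalCone {S : Set (EuclideanSpace ℝ (Fin n))}
    {x : EuclideanSpace ℝ (Fin n)} : regularNormalCone S x ⊆ limitingNormalCone S x :=
  fun w hw => ⟨hw.1, fun _ => x, fun _ => w, fun _ => hw, tendsto_const_nhds, tendsto_const_nhds⟩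

theorem inner_nonpos_of_mem_regularNormalCone (hψ : MovingSetAssumptions T ψ r β η ρ) {t : ℝ}
    (ht : t ∈ Icc 0 T) {x v w : EuclideanSpace ℝ (Fin n)}
    (hw : w ∈ regularNormalCone (movingSet ψ t) x)
    (hv : ∀ j, ψ j t x = 0 → inner ℝ (gradient (ψ j t) x) v < 0) : inner ℝ w v ≤ 0 := by
  by_contra! hpos
  have hε : 0 < inner ℝ w v / (2 * (‖v‖ + 1)) := by positivity
  have h1 := hψ.eventually_lt_zero_of_inner_neg ht hw.1 hv
  have h2 : Tendsto (fun s : ℝ => x + s • v) (𝓝[>] 0) (𝓝[movingSet ψ t] x) := by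
    have hc : Continuous fun s : ℝ => x + s • v := by fun_prop
    refine tendsto_nhdsWithin_iff.2 ⟨by simpa using (hc.tendsto 0).mono_left nhdsWithin_le_nhds, ?_⟩
    filter_upwards [h1] with s hs j using (hs j).le
  obtain ⟨s, hs, hs0⟩ := ((h2.eventually (hw.2 _ hε)).and self_mem_nhdsWithin).exists
  have hs0' : (0:ℝ) < s := hs0
  rw [add_sub_cancel_left, inner_smul_right, norm_smul, Real.norm_of_nonneg hs0'.le] at hs
  have h3 : inner ℝ w v ≤ inner ℝ w v / (2 * (‖v‖ + 1)) * ‖v‖ := by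
    refine le_of_mul_le_mul_left ?_ hs0'
    linarith
  rw [div_mul_eq_mul_div, le_div_iff₀ (by positivity)] at h3
  nlinarith [norm_nonneg v]

/-- The quadratic lower bound on a constraint function, at two points of the moving set. -/
theorem exists_inner_gradient_le (hT : 0 < T) (hψ : MovingSetAssumptions T ψ r β η ρ) :
    ∃ K : ℝ, 0 < K ∧ ∀ t ∈ Icc 0 T, ∀ x ∈ movingSet ψ t,
      (∀ i, ‖gradient (ψ i t) x‖ ≤ K) ∧
      ∀ z ∈ movingSet ψ t, ∀ i, ψ i t x = 0 →
        inner ℝ (gradient (ψ i t) x) (z - x) ≤ K * ‖z - x‖ ^ 2 := by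
  obtain ⟨K, hK0, hK⟩ := hψ.exists_gradient_bound hT r
  refine ⟨K, hK0, fun t ht x hx =>
    ⟨fun i => (hK t ht i).1 x (hψ.mem_closedBall_of_mem_movingSet ht hx), fun z hz i hi => ?_⟩⟩
  have hxr := hψ.mem_closedBall_of_mem_movingSet ht hx
  have hzr := hψ.mem_closedBall_of_mem_movingSet ht hz
  have hseg : segment ℝ x z ⊆ Metric.closedBall 0 r :=
    (convex_closedBall _ _).segment_subset hxr hzr
  have h1 := (convex_segment x z).norm_image_sub_le_of_norm_hasFDerivWithin_le'
    (f := ψ i t) (f' := fun y => InnerProductSpace.toDual ℝ _ (gradient (ψ i t) y))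
    (φ := InnerProductSpace.toDual ℝ _ (gradient (ψ i t) x)) (C := K * ‖z - x‖)
    (fun y _ => (hψ.hasGradientAt i ht y).hasFDerivAt.hasFDerivWithinAt)
    (fun y hy => by
      rw [← map_sub, LinearIsometryEquiv.norm_map]
      refine ((hK t ht i).2 y (hseg hy) x hxr).trans (mul_le_mul_of_nonneg_left ?_ hK0.le)
      rw [norm_sub_rev]
      have := norm_sub_le_of_mem_segment hy
      rw [norm_sub_rev]
      exact this)
    (left_mem_segment ℝ x z) (right_mem_segment ℝ x z)
  rw [InnerProductSpace.toDual_apply_apply, hi, sub_zero, Real.norm_eq_abs] at h1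
  have h2 := (abs_le.1 h1).1
  have h3 : ψ i t z ≤ 0 := hz i
  nlinarith

/-- The moving sets are uniformly prox-regular: limiting normals are characterized by a quadratic
inequality with a constant that does not depend on time. -/
theorem exists_mem_limitingNormalCone_iff (hT : 0 < T) (hψ : MovingSetAssumptions T ψ r β η ρ) :
    ∃ c : ℝ, 0 ≤ c ∧ ∀ t ∈ Icc 0 T, ∀ x w, w ∈ limitingNormalCone (movingSet ψ t) x ↔
      x ∈ movingSet ψ t ∧ ∀ z ∈ movingSet ψ t, inner ℝ w (z - x) ≤ c * ‖w‖ * ‖z - x‖ ^ 2 := by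
  obtain ⟨K, hK0, hK⟩ := hψ.exists_inner_gradient_le hT
  have hη := hψ.η_pos
  set a : ℝ := (K + 1) / η ^ 2 with ha
  have ha0 : 0 < a := by positivity
  refine ⟨a * (I * K), by positivity, fun t ht x w => ⟨fun hw => ?_, fun hw =>
    regularNormalCone_subset_limitingNormalCone (mem_regularNormalCone_of_quadratic hw.1 hw.2)⟩⟩
  have hdir : ∀ p ∈ movingSet ψ t, ‖inwardDirection ψ t p‖ ≤ I * K := fun p hp => by
    classical
    rw [inwardDirection, norm_neg]
    refine (norm_sum_le_of_le _ fun i _ => (hK t ht p hp).1 i).trans ?_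
    rw [Finset.sum_const, nsmul_eq_mul]
    refine mul_le_mul_of_nonneg_right ?_ hK0.le
    exact_mod_cast (Finset.card_le_univ _).trans (by simp)
  -- the chord to `z` is tilted inwards by a quadratic amount, so as to become an inward direction
  have hreg : ∀ p v, v ∈ regularNormalCone (movingSet ψ t) p → ∀ z ∈ movingSet ψ t,
      inner ℝ v (z - p) ≤ a * (I * K) * ‖v‖ * ‖z - p‖ ^ 2 := by
    intro p v hv z hz
    rcases eq_or_ne z p with rfl | hzp
    · simp
    have hpos : 0 < ‖z - p‖ ^ 2 := by have := norm_pos_iff.2 (sub_ne_zero.2 hzp); positivity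
    have h1 := hψ.inner_nonpos_of_mem_regularNormalCone ht hv
      (v := (z - p) + (a * ‖z - p‖ ^ 2) • inwardDirection ψ t p) fun j hj => by
        rw [inner_add_right, inner_smul_right]
        have e1 := (hK t ht p hv.1).2 z hz j hj
        have e2 := mul_le_mul_of_nonneg_left (hψ.inner_gradient_inwardDirection ht hj)
          (mul_pos ha0 hpos).le
        have e3 : a * ‖z - p‖ ^ 2 * -η ^ 2 = -(K + 1) * ‖z - p‖ ^ 2 := by
          rw [ha]; field_simp
        nlinarith
    rw [inner_add_right, inner_smul_right] at h1
    have h2 : -inner ℝ v (inwardDirection ψ t p) ≤ ‖v‖ * (I * K) :=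
      (neg_le_abs _).trans ((abs_real_inner_le_norm _ _).trans
        (mul_le_mul_of_nonneg_left (hdir p hv.1) (norm_nonneg _)))
    have h3 := mul_le_mul_of_nonneg_left h2 (mul_pos ha0 hpos).le
    nlinarith
  obtain ⟨hx, p, v, hv, hp, hvw⟩ := hw
  refine ⟨hx, fun z hz => ?_⟩
  refine le_of_tendsto_of_tendsto' (hvw.inner (tendsto_const_nhds.sub hp))
    ((hvw.norm.const_mul _).mul ((tendsto_const_nhds.sub hp).norm.pow 2))
    fun k => hreg (p k) (v k) (hv k) z hz

theorem sum_smul_gradient_mem_limitingNormalCone (hT : 0 < T)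
    (hψ : MovingSetAssumptions T ψ r β η ρ) {t : ℝ} (ht : t ∈ Icc 0 T)
    {x : EuclideanSpace ℝ (Fin n)} (hx : x ∈ movingSet ψ t) {l : Fin I → ℝ} (hl : ∀ i, 0 ≤ l i)
    (hl0 : ∀ i, ψ i t x < 0 → l i = 0) :
    ∑ i, l i • gradient (ψ i t) x ∈ limitingNormalCone (movingSet ψ t) x := by
  obtain ⟨K, hK0, hK⟩ := hψ.exists_inner_gradient_le hT
  refine regularNormalCone_subset_limitingNormalCone
    (mem_regularNormalCone_of_quadratic (c := (∑ i, l i) * K) hx fun z hz => ?_)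
  rw [sum_inner, Finset.sum_mul, Finset.sum_mul]
  refine Finset.sum_le_sum fun i _ => ?_
  rw [real_inner_smul_left, mul_assoc]
  rcases (hx i).lt_or_eq with h | h
  · simp [hl0 i h]
  · exact mul_le_mul_of_nonneg_left ((hK t ht x hx).2 z hz i h) (hl i)

theorem isClosed_graph (hψ : MovingSetAssumptions T ψ r β η ρ) :
    IsClosed {p : ℝ × EuclideanSpace ℝ (Fin n) | p.1 ∈ Icc 0 T ∧ p.2 ∈ movingSet ψ p.1} :=
  hψ.isCompact_graph.isClosed

/-- The normal cones have a closed graph as the time and the point vary. -/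
theorem isClosed_graph_limitingNormalCone (hT : 0 < T) (hψ : MovingSetAssumptions T ψ r β η ρ) :
    IsClosed {p : ℝ × EuclideanSpace ℝ (Fin n) × EuclideanSpace ℝ (Fin n) |
      p.1 ∈ Icc 0 T ∧ p.2.2 ∈ limitingNormalCone (movingSet ψ p.1) p.2.1} := by
  obtain ⟨c, -, hc⟩ := hψ.exists_mem_limitingNormalCone_iff hT
  refine IsSeqClosed.isClosed fun p q hp hpq => ?_
  have h1 : Tendsto (fun k => (p k).1) atTop (𝓝 q.1) := hpq.fst_nhds
  have h2 : Tendsto (fun k => (p k).2.1) atTop (𝓝 q.2.1) := hpq.snd_nhds.fst_nhds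
  have h3 : Tendsto (fun k => (p k).2.2) atTop (𝓝 q.2.2) := hpq.snd_nhds.snd_nhds
  have hq : q.1 ∈ Icc 0 T ∧ q.2.1 ∈ movingSet ψ q.1 :=
    hψ.isClosed_graph.mem_of_tendsto (h1.prodMk_nhds h2)
      (Eventually.of_forall fun k => ⟨(hp k).1, ((hc _ (hp k).1 _ _).1 (hp k).2).1⟩)
  refine ⟨hq.1, (hc _ hq.1 _ _).2 ⟨hq.2, ?_⟩⟩
  -- strictly feasible points stay feasible at nearby times, and they are dense
  have hcl : IsClosed {z | inner ℝ q.2.2 (z - q.2.1) ≤ c * ‖q.2.2‖ * ‖z - q.2.1‖ ^ 2} :=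
    isClosed_le (by fun_prop) (by fun_prop)
  refine (hψ.movingSet_subset_closure hq.1).trans (hcl.closure_subset_iff.2 fun z hz => ?_)
  have hev : ∀ᶠ k in atTop, z ∈ movingSet ψ (p k).1 := by
    simp only [movingSet, mem_ofPred_eq]
    rw [eventually_all]
    intro i
    have hcont := hψ.continuousOn_joint i (q.1, z) ⟨hq.1, mem_univ _⟩
    have ht : Tendsto (fun k => ((p k).1, z)) atTop (𝓝[Icc 0 T ×ˢ univ] (q.1, z)) :=
      tendsto_nhdsWithin_iff.2 ⟨h1.prodMk_nhds tendsto_const_nhds,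
        Eventually.of_forall fun k => ⟨(hp k).1, mem_univ _⟩⟩
    exact ((hcont.tendsto.comp ht).eventually_lt_const (hz i)).mono fun k hk => hk.le
  refine le_of_tendsto_of_tendsto (h3.inner (tendsto_const_nhds.sub h2))
    ((h3.norm.const_mul c).mul ((tendsto_const_nhds.sub h2).norm.pow 2)) ?_
  filter_upwards [hev] with k hk using ((hc _ (hp k).1 _ _).1 (hp k).2).2 z hk

end MovingSetAssumptions

namespace MovingSetAssumptions

variable {n I : ℕ} {T r β η ρ : ℝ} {ψ : Fin I → ℝ → EuclideanSpace ℝ (Fin n) → ℝ}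

/-! ### Nearly feasible points are close to the moving set -/

/-- A linear error bound. The total violation `φ = ∑ max ψⁱ 0` has slope greater than `η` wherever
it is positive and small, so a minimizer of `φ + (η/2) ‖· - x‖` is feasible. -/
theorem exists_mem_movingSet_norm_sub_le (hψ : MovingSetAssumptions T ψ r β η ρ) {t ε : ℝ}
    (ht : t ∈ Icc 0 T) (hε : 0 ≤ ε) (hεβ : I * ε ≤ β) {x : EuclideanSpace ℝ (Fin n)}
    (hx : ∀ i, ψ i t x ≤ ε) :
    ∃ c ∈ movingSet ψ t, η / 2 * ‖c - x‖ ≤ I * ε := by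
  classical
  have hη := hψ.η_pos
  have hβ := hψ.β_pos
  set φ : EuclideanSpace ℝ (Fin n) → ℝ := fun y => ∑ i, max (ψ i t y) 0 with hφ
  have hφc : Continuous φ :=
    continuous_finsetSum _ fun i _ => (hψ.continuous_slice i ht).max continuous_const
  have hφ0 : ∀ y, 0 ≤ φ y := fun y => Finset.sum_nonneg fun i _ => le_max_right _ _
  have hφi : ∀ y i, ψ i t y ≤ φ y := fun y i => (le_max_left _ _).trans
    (Finset.single_le_sum (f := fun i => max (ψ i t y) 0) (fun j _ => le_max_right _ _)
      (Finset.mem_univ i))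
  have hφx : φ x ≤ I * ε := by
    refine (Finset.sum_le_sum fun i _ => max_le (hx i) hε).trans ?_
    simp
  have hlim : Tendsto (fun y => φ y + η / 2 * ‖y - x‖)
      (cocompact (EuclideanSpace ℝ (Fin n))) atTop := by
    refine tendsto_atTop_mono (fun y => le_add_of_nonneg_left (hφ0 y))
      (Tendsto.const_mul_atTop (by positivity) ?_)
    refine tendsto_norm_cocompact_atTop.comp ?_
    simpa [sub_eq_add_neg] using (Homeomorph.addRight (-x)).isClosedEmbedding.tendsto_cocompact
  obtain ⟨y, hy⟩ := (show Continuous fun y => φ y + η / 2 * ‖y - x‖ by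
    fun_prop).exists_forall_le hlim
  have hyx : φ y + η / 2 * ‖y - x‖ ≤ I * ε := by
    have := hy x
    simp only [sub_self, norm_zero, mul_zero, add_zero] at this
    exact this.trans hφx
  have hyn : 0 ≤ η / 2 * ‖y - x‖ := by positivity
  refine ⟨y, ?_, by linarith [hφ0 y]⟩
  by_contra hyC
  have hyβ : ∀ i, ψ i t y ≤ β := fun i => (hφi y i).trans (by linarith)
  set J : Finset (Fin I) := Finset.univ.filter fun i => 0 < ψ i t y with hJ
  have hJna : J ⊆ nearActive ψ β t y := fun i hi =>
    mem_nearActive_iff.2 ⟨by linarith [(Finset.mem_filter.1 hi).2], hyβ i⟩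
  obtain ⟨j, hj⟩ : ∃ j, 0 < ψ j t y := by
    by_contra! h
    exact hyC h
  have hjJ : j ∈ J := by simpa [hJ] using hj
  set d := -∑ i ∈ J, gradient (ψ i t) y with hd
  have hdη : η < ‖d‖ := by
    have h1 := hψ.gradient_bound t ht y j ⟨by linarith, hyβ j⟩
    have h2 := hψ.inner_gradient_neg_sum_le ht hJna (hJna hjJ)
    rw [if_pos hjJ, ← hd] at h2
    have h3 := (abs_le.1 (abs_real_inner_le_norm (gradient (ψ j t) y) d)).1
    have h4 : 0 < ‖gradient (ψ j t) y‖ := hη.trans h1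
    have : ‖gradient (ψ j t) y‖ ≤ ‖d‖ := le_of_mul_le_mul_left (by nlinarith) h4
    linarith
  have hdd : ∑ i ∈ J, inner ℝ (gradient (ψ i t) y) d = -‖d‖ ^ 2 := by
    rw [← sum_inner, ← real_inner_self_eq_norm_sq]
    nth_rewrite 2 [hd]
    rw [inner_neg_left, neg_neg]
  set κ : ℝ := η ^ 2 / (4 * (I + 1)) with hκ
  have hκ0 : 0 < κ := by positivity
  have hev : ∀ i, ∀ᶠ s : ℝ in 𝓝[>] 0, max (ψ i t (y + s • d)) 0 ≤
      max (ψ i t y) 0 + s * ((if i ∈ J then inner ℝ (gradient (ψ i t) y) d else 0) + κ) := by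
    intro i
    have hpos : ∀ᶠ s : ℝ in 𝓝[>] 0, 0 < s := self_mem_nhdsWithin
    rcases lt_trichotomy (ψ i t y) 0 with h | h | h
    · have hiJ : i ∉ J := by simp [hJ, h.le]
      have hc : Continuous fun s : ℝ => ψ i t (y + s • d) :=
        (hψ.continuous_slice i ht).comp (by fun_prop)
      have h0 : ∀ᶠ s : ℝ in 𝓝[>] 0, ψ i t (y + s • d) < 0 :=
        (hc.continuousAt.eventually_lt_const (by simpa using h)).filter_mono nhdsWithin_le_nhds
      filter_upwards [h0, hpos] with s hs hs0
      rw [if_neg hiJ, max_eq_right hs.le, max_eq_right h.le]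
      positivity
    · have hiJ : i ∉ J := by simp [hJ, h.le]
      have hna : i ∈ nearActive ψ β t y := mem_nearActive_iff.2 ⟨by linarith, hyβ i⟩
      have h2 := hψ.inner_gradient_neg_sum_le ht hJna hna
      rw [if_neg hiJ] at h2
      filter_upwards [(hψ.hasGradientAt i ht y).eventually_lt_add_mul (h2.trans_lt hκ0), hpos]
        with s hs hs0
      rw [if_neg hiJ, zero_add, h, max_self, zero_add]
      rw [h, zero_add] at hs
      exact max_le hs.le (by positivity)
    · have hiJ : i ∈ J := by simpa [hJ] using h
      have hc : Continuous fun s : ℝ => ψ i t y + s * (inner ℝ (gradient (ψ i t) y) d + κ) := by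
        fun_prop
      have h0 : ∀ᶠ s : ℝ in 𝓝[>] 0, 0 < ψ i t y + s * (inner ℝ (gradient (ψ i t) y) d + κ) :=
        (hc.continuousAt.eventually_const_lt (by simpa using h)).filter_mono nhdsWithin_le_nhds
      filter_upwards [(hψ.hasGradientAt i ht y).eventually_lt_add_mul
        (lt_add_of_pos_right _ hκ0), h0] with s hs hs0
      rw [if_pos hiJ, max_eq_left h.le]
      exact max_le hs.le hs0.le
  obtain ⟨s, hs, hs0⟩ := ((eventually_all.2 hev).and self_mem_nhdsWithin).exists
  have hs0' : (0:ℝ) < s := hs0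
  have h1 : φ (y + s • d) ≤ φ y + s * (-‖d‖ ^ 2 + I * κ) := by
    refine (Finset.sum_le_sum fun i _ => hs i).trans_eq ?_
    rw [Finset.sum_add_distrib, ← Finset.mul_sum, Finset.sum_add_distrib, ← hdd,
      Finset.sum_ite_mem, Finset.univ_inter]
    simp [hφ]
  have h2 := hy (y + s • d)
  have h3 : ‖y + s • d - x‖ ≤ ‖y - x‖ + s * ‖d‖ := by
    have : y + s • d - x = (y - x) + s • d := by abel
    rw [this]
    refine (norm_add_le _ _).trans_eq ?_
    rw [norm_smul, Real.norm_of_nonneg hs0'.le]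
  have h4 : η / 2 * ‖y + s • d - x‖ ≤ η / 2 * (‖y - x‖ + s * ‖d‖) :=
    mul_le_mul_of_nonneg_left h3 (by positivity)
  have h5 : 0 ≤ s * (-‖d‖ ^ 2 + I * κ + η / 2 * ‖d‖) := by nlinarith
  have h6 : 0 ≤ -‖d‖ ^ 2 + I * κ + η / 2 * ‖d‖ := nonneg_of_mul_nonneg_right h5 hs0'
  have h7 : I * κ ≤ η ^ 2 / 4 := by
    rw [hκ, mul_div_assoc', div_le_div_iff₀ (by positivity) (by norm_num)]
    nlinarith [sq_nonneg η]
  nlinarith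

/-- At a small level `ε`, the sublevel sets of the constraints stay within unit distance of the
moving set and in a ball of radius less than `r`. -/
theorem exists_tube (hψ : MovingSetAssumptions T ψ r β η ρ) :
    ∃ ε q : ℝ, 0 < ε ∧ ε ≤ β ∧ q < r ^ 2 ∧ ∀ t ∈ Icc 0 T, ∀ x, (∀ i, ψ i t x ≤ ε) →
      (∃ c ∈ movingSet ψ t, ‖x - c‖ ≤ 1) ∧ t ^ 2 + ‖x‖ ^ 2 ≤ q := by
  have hη := hψ.η_pos
  have hβ := hψ.β_pos
  have hr := hψ.r_pos
  obtain ⟨q, hq0, hq, hmax⟩ : ∃ q : ℝ, 0 ≤ q ∧ q < r ^ 2 ∧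
      ∀ t ∈ Icc 0 T, ∀ x ∈ movingSet ψ t, t ^ 2 + ‖x‖ ^ 2 ≤ q := by
    rcases eq_empty_or_nonempty
      {p : ℝ × EuclideanSpace ℝ (Fin n) | p.1 ∈ Icc 0 T ∧ p.2 ∈ movingSet ψ p.1} with he | hne
    · exact ⟨0, le_rfl, by positivity, fun t ht x hx =>
        (eq_empty_iff_forall_notMem.1 he (t, x) ⟨ht, hx⟩).elim⟩
    · obtain ⟨p, hp, hpmax⟩ := hψ.isCompact_graph.exists_isMaxOn hne
        (f := fun p => p.1 ^ 2 + ‖p.2‖ ^ 2) (by fun_prop)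
      exact ⟨_, by positivity, hψ.graph_in_ball p.1 hp.1 p.2 hp.2,
        fun t ht x hx => hpmax (a := (t, x)) ⟨ht, hx⟩⟩
  obtain ⟨δ, hδ0, hδ1, hδ⟩ : ∃ δ : ℝ, 0 < δ ∧ δ ≤ 1 ∧ q + (2 * r * δ + δ ^ 2) < r ^ 2 := by
    have hc : Continuous fun δ : ℝ => q + (2 * r * δ + δ ^ 2) := by fun_prop
    have h1 : ∀ᶠ δ : ℝ in 𝓝[>] 0, q + (2 * r * δ + δ ^ 2) < r ^ 2 :=
      (hc.continuousAt.eventually_lt_const (by simpa using hq)).filter_mono nhdsWithin_le_nhds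
    obtain ⟨δ, h, h'⟩ := (h1.and (Ioc_mem_nhdsGT (zero_lt_one' ℝ))).exists
    exact ⟨δ, h'.1, h'.2, h⟩
  set ε := min (β / (I + 1)) (η / 2 * δ / (I + 1)) with hεdef
  have hε0 : 0 < ε := lt_min (by positivity) (by positivity)
  have hI1 : (0:ℝ) < I + 1 := by positivity
  have hε1 : (I + 1) * ε ≤ β := by
    have := min_le_left (β / (I + 1)) (η / 2 * δ / (I + 1))
    rw [← hεdef, le_div_iff₀ hI1] at this
    linarith
  have hε2 : (I + 1) * ε ≤ η / 2 * δ := by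
    have := min_le_right (β / (I + 1)) (η / 2 * δ / (I + 1))
    rw [← hεdef, le_div_iff₀ hI1] at this
    linarith
  have hIε : 0 ≤ I * ε := by positivity
  refine ⟨ε, q + (2 * r * δ + δ ^ 2), hε0, by linarith, hδ, fun t ht x hx => ?_⟩
  obtain ⟨c, hc, hcx⟩ := hψ.exists_mem_movingSet_norm_sub_le ht hε0.le (by linarith) hx
  have hcδ : ‖x - c‖ ≤ δ := by
    rw [norm_sub_rev]
    exact le_of_mul_le_mul_left (by linarith : η / 2 * ‖c - x‖ ≤ η / 2 * δ) (by positivity)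
  refine ⟨⟨c, hc, hcδ.trans hδ1⟩, ?_⟩
  have h1 := hmax t ht c hc
  have h2 : ‖c‖ ≤ r := by simpa using hψ.mem_closedBall_of_mem_movingSet ht hc
  have h3 : ‖x‖ ≤ ‖c‖ + δ := by
    have := norm_add_le c (x - c)
    rw [add_sub_cancel] at this
    linarith
  have h4 : ‖x‖ ^ 2 ≤ (‖c‖ + δ) ^ 2 := by gcongr
  nlinarith [norm_nonneg c]

end MovingSetAssumptions

/-! ### Bounds for the dynamics -/

section Dynamics

variable {n m I : ℕ} {T r M : ℝ}
  {f : ℝ → EuclideanSpace ℝ (Fin n) → EuclideanSpace ℝ (Fin m) → EuclideanSpace ℝ (Fin n)}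
  {U : Set (EuclideanSpace ℝ (Fin m))}

theorem DynamicsAssumptions.norm_sub_le (hf : DynamicsAssumptions T f U r M) {t : ℝ}
    (ht : t ∈ Icc 0 T) {a : EuclideanSpace ℝ (Fin m)} (ha : a ∈ U) {x y : EuclideanSpace ℝ (Fin n)}
    (hx : t ^ 2 + ‖x‖ ^ 2 ≤ r ^ 2) (hy : t ^ 2 + ‖y‖ ^ 2 ≤ r ^ 2) :
    ‖f t x a - f t y a‖ ≤ M * ‖x - y‖ := by
  refine Convex.norm_image_sub_le_of_norm_fderiv_le (f := fun z => f t z a)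
    (fun z _ => ((hf.contDiff t ht a).differentiable (by simp)).differentiableAt) (fun z hz => ?_)
    (convex_closedBall (0 : EuclideanSpace ℝ (Fin n)) (max ‖x‖ ‖y‖)) (by simp) (by simp)
  refine hf.bound_fderiv t ht z ?_ a ha
  rw [mem_closedBall_zero_iff] at hz
  rcases max_cases ‖x‖ ‖y‖ with h | h <;> rw [h.1] at hz
  · have : ‖z‖ ^ 2 ≤ ‖x‖ ^ 2 := by gcongr
    linarith
  · have : ‖z‖ ^ 2 ≤ ‖y‖ ^ 2 := by gcongr
    linarith

/-- Superposition of a function that is continuous on a strip with a measurable curve. -/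
theorem ContinuousOn.aestronglyMeasurable_comp_strip {X F : Type*} [TopologicalSpace X]
    [SecondCountableTopology X] [MeasurableSpace X] [BorelSpace X] [NormedAddCommGroup F]
    [SecondCountableTopology F] {g : ℝ × X → F} (hg : ContinuousOn g (Icc 0 T ×ˢ univ))
    {x : ℝ → X} (hx : AEMeasurable x (volume.restrict (Icc 0 T))) :
    AEStronglyMeasurable (fun s => g (s, x s)) (volume.restrict (Icc 0 T)) := by
  classical
  borelize F
  have h1 : Measurable ((Icc 0 T ×ˢ (univ : Set X)).piecewise g fun _ => 0) :=
    hg.measurable_piecewise continuousOn_const (measurableSet_Icc.prod MeasurableSet.univ)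
  have h2 : AEMeasurable (fun s => (s, x s)) (volume.restrict (Icc 0 T)) :=
    aemeasurable_id'.prodMk hx
  refine ((h1.comp_aemeasurable h2).congr ?_).aestronglyMeasurable
  filter_upwards [ae_restrict_mem measurableSet_Icc] with s hs
  simp [hs.1, hs.2]

theorem DynamicsAssumptions.aestronglyMeasurable (hf : DynamicsAssumptions T f U r M)
    {x : ℝ → EuclideanSpace ℝ (Fin n)} {u : ℝ → EuclideanSpace ℝ (Fin m)}
    (hx : AEMeasurable x (volume.restrict (Icc 0 T)))
    (hu : AEMeasurable u (volume.restrict (Icc 0 T))) :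
    AEStronglyMeasurable (fun s => f s (x s) (u s)) (volume.restrict (Icc 0 T)) :=
  ContinuousOn.aestronglyMeasurable_comp_strip
    (g := fun p : ℝ × EuclideanSpace ℝ (Fin n) × EuclideanSpace ℝ (Fin m) => f p.1 p.2.1 p.2.2)
    hf.continuousOn (hx.prodMk hu)

theorem IsControl.nonempty (hT : 0 < T) {u : ℝ → EuclideanSpace ℝ (Fin m)}
    (hu : IsControl T U u) : U.Nonempty := by
  have : NeZero (volume.restrict (Icc 0 T)) := ⟨by
    rw [Ne, Measure.restrict_eq_zero, Real.volume_Icc]; simpa using hT⟩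
  obtain ⟨t, ht⟩ := hu.2.exists
  exact ⟨_, ht⟩

end Dynamics

section Penalty

variable {n m I : ℕ} {T r β η ρ M μ : ℝ}
  {f : ℝ → EuclideanSpace ℝ (Fin n) → EuclideanSpace ℝ (Fin m) → EuclideanSpace ℝ (Fin n)}
  {U : Set (EuclideanSpace ℝ (Fin m))} {ψ : Fin I → ℝ → EuclideanSpace ℝ (Fin n) → ℝ}
  {γ σ : ℕ → ℝ}

/-! ### Invariance of the enlarged sets under the penalized dynamics -/

/-- The right-hand side of the penalized equation. -/
noncomputable def penaltyField
    (f : ℝ → EuclideanSpace ℝ (Fin n) → EuclideanSpace ℝ (Fin m) → EuclideanSpace ℝ (Fin n))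
    (ψ : Fin I → ℝ → EuclideanSpace ℝ (Fin n) → ℝ) (g s t : ℝ) (x : EuclideanSpace ℝ (Fin n))
    (a : EuclideanSpace ℝ (Fin m)) : EuclideanSpace ℝ (Fin n) :=
  f t x a - ∑ i, (g * Real.exp (g * (ψ i t x - s))) • gradient (ψ i t) x

/-- At the penalty level the multiplier `γ exp (γ (ψ - σ))` equals `μ / η²`. -/
theorem mul_exp_penaltyLevel {g : ℝ} (hμ : 0 < μ) (hη : 0 < η) (hg : 0 < g) :
    g * Real.exp (g * penaltyLevel μ η g) = μ / η ^ 2 := by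
  have h1 : g * penaltyLevel μ η g = Real.log (μ / (η ^ 2 * g)) := by
    rw [penaltyLevel]; field_simp
  rw [h1, Real.exp_log (by positivity)]
  field_simp

theorem tendsto_penaltyLevel (hγ : Tendsto γ atTop atTop) (hη : 0 < η) :
    Tendsto (fun k => penaltyLevel μ η (γ k)) atTop (𝓝 0) := by
  rcases eq_or_ne μ 0 with rfl | hμ
  · simp [penaltyLevel]
  have h1 : Tendsto (fun g : ℝ => 1 / g * Real.log (μ / η ^ 2) - Real.log g / g) atTop (𝓝 0) := by
    have ha : Tendsto (fun g : ℝ => 1 / g * Real.log (μ / η ^ 2)) atTop (𝓝 0) := by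
      simpa using tendsto_inv_atTop_zero.mul_const (Real.log (μ / η ^ 2))
    simpa using ha.sub Real.isLittleO_log_id_atTop.tendsto_div_nhds_zero
  refine (h1.comp hγ).congr' ?_
  filter_upwards [hγ.eventually_gt_atTop 0] with k hk
  simp only [Function.comp_apply, penaltyLevel]
  rw [← div_div, Real.log_div (div_ne_zero hμ (by positivity)) hk.ne']
  ring

/-- The levels of the enlarged sets vanish in the limit. -/
theorem PenaltyParameters.tendsto_level (hpar : PenaltyParameters T f U ψ η μ γ σ) (hη : 0 < η) :
    Tendsto (fun k => σ k + penaltyLevel μ η (γ k)) atTop (𝓝 0) := by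
  simpa using hpar.σ_tendsto.add (tendsto_penaltyLevel hpar.γ_tendsto hη)

theorem PenaltyParameters.one_le (hpar : PenaltyParameters T f U ψ η μ γ σ) {t : ℝ}
    (ht : t ∈ Icc 0 T) {c : EuclideanSpace ℝ (Fin n)} (hc : c ∈ movingSet ψ t) (hU : U.Nonempty)
    (i : Fin I) : 1 ≤ μ := by
  obtain ⟨a, ha⟩ := hU
  have := hpar.μ_bound t ht a ha c hc c (by simp) i
  have h1 : 0 ≤ ‖gradient (ψ i t) c‖ * ‖f t c a‖ := by positivity
  have h2 := abs_nonneg (derivWithin (fun s => ψ i s c) (Icc 0 T) t)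
  linarith

theorem PenaltyParameters.multiplier_le (hpar : PenaltyParameters T f U ψ η μ γ σ) (hη : 0 < η)
    (hμ : 0 < μ) {k : ℕ} {v : ℝ} (hv : v ≤ σ k + penaltyLevel μ η (γ k)) :
    γ k * Real.exp (γ k * (v - σ k)) ≤ μ / η ^ 2 := by
  have hγ := hpar.γ_pos k
  rw [← mul_exp_penaltyLevel hμ hη hγ]
  have : v - σ k ≤ penaltyLevel μ η (γ k) := by linarith
  gcongr

/-- Above the penalty level, a constraint function decreases along the penalized dynamics: its own
penalty term dominates, and the other ones do not counteract it as the gradients form acute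
angles. -/
theorem PenaltyParameters.inner_penaltyField_le (hpar : PenaltyParameters T f U ψ η μ γ σ)
    (hψ : MovingSetAssumptions T ψ r β η ρ) {k : ℕ} {t : ℝ} (ht : t ∈ Icc 0 T)
    {x c : EuclideanSpace ℝ (Fin n)} (hc : c ∈ movingSet ψ t) (hxc : ‖x - c‖ ≤ 1)
    {a : EuclideanSpace ℝ (Fin m)} (ha : a ∈ U) (hx : ∀ j, ψ j t x ≤ β)
    (hℓ : -β ≤ σ k + penaltyLevel μ η (γ k)) {i : Fin I}
    (hi : σ k + penaltyLevel μ η (γ k) < ψ i t x) :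
    derivWithin (fun s => ψ i s x) (Icc 0 T) t +
      inner ℝ (gradient (ψ i t) x) (penaltyField f ψ (γ k) (σ k) t x a) ≤ -1 := by
  have hη := hψ.η_pos
  have hβ := hψ.β_pos
  have hγ := hpar.γ_pos k
  have hμ : 0 < μ := one_pos.trans_le (hpar.one_le ht hc ⟨a, ha⟩ i)
  have hb := hpar.μ_bound t ht a ha c hc x hxc i
  have hina : i ∈ nearActive ψ β t x :=
    MovingSetAssumptions.mem_nearActive_iff.2 ⟨by linarith, hx i⟩
  have hnn : ∀ j, 0 ≤ γ k * Real.exp (γ k * (ψ j t x - σ k)) *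
      inner ℝ (gradient (ψ i t) x) (gradient (ψ j t) x) := fun j => by
    rcases le_or_gt (ψ j t x) (-(2 * β)) with h | h
    · rw [hψ.gradient_zero t ht x j h]; simp
    · exact mul_nonneg (by positivity) (hψ.inner_nonneg t ht x i hina j
        (MovingSetAssumptions.mem_nearActive_iff.2 ⟨h, hx j⟩))
  have hself : μ ≤ γ k * Real.exp (γ k * (ψ i t x - σ k)) *
      inner ℝ (gradient (ψ i t) x) (gradient (ψ i t) x) := by
    rw [real_inner_self_eq_norm_sq]
    have h1 : μ / η ^ 2 ≤ γ k * Real.exp (γ k * (ψ i t x - σ k)) := by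
      rw [← mul_exp_penaltyLevel hμ hη hγ]
      have : penaltyLevel μ η (γ k) ≤ ψ i t x - σ k := by linarith
      gcongr
    have h2 : η ≤ ‖gradient (ψ i t) x‖ :=
      (hψ.gradient_bound t ht x i ⟨by linarith, hx i⟩).le
    calc μ = μ / η ^ 2 * η ^ 2 := by field_simp
      _ ≤ _ := by gcongr
  have hsum := hself.trans (Finset.single_le_sum (fun j _ => hnn j) (Finset.mem_univ i))
  rw [penaltyField, inner_sub_right, inner_sum]
  simp only [inner_smul_right]
  have h3 := (le_abs_self _).trans (abs_real_inner_le_norm (gradient (ψ i t) x) (f t x a))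
  have h4 := le_abs_self (derivWithin (fun s => ψ i s x) (Icc 0 T) t)
  linarith

/-- A curve that follows the penalized dynamics while it is in a tube around the moving set, and
starts in the enlarged set, stays in the enlarged set. -/
theorem PenaltyParameters.le_level_of_penaltyField (hT : 0 < T)
    (hpar : PenaltyParameters T f U ψ η μ γ σ) (hψ : MovingSetAssumptions T ψ r β η ρ) {ε : ℝ}
    (hεβ : ε ≤ β)
    (htube : ∀ t ∈ Icc 0 T, ∀ x, (∀ i, ψ i t x ≤ ε) → ∃ c ∈ movingSet ψ t, ‖x - c‖ ≤ 1)
    {k : ℕ} (hℓ : -β ≤ σ k + penaltyLevel μ η (γ k)) (hℓε : σ k + penaltyLevel μ η (γ k) < ε)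
    {u : ℝ → EuclideanSpace ℝ (Fin m)} (hu : ∀ᵐ t ∂volume.restrict (Icc 0 T), u t ∈ U)
    {x : ℝ → EuclideanSpace ℝ (Fin n)} (hx : AbsolutelyContinuousOnInterval x 0 T)
    (hx0 : x 0 ∈ enlargedSet ψ μ η (γ k) (σ k) 0)
    (hd : ∀ᵐ t ∂volume.restrict (Icc 0 T), (∀ i, ψ i t (x t) ≤ ε) →
      HasDerivAt x (penaltyField f ψ (γ k) (σ k) t (x t) (u t)) t) :
    ∀ t ∈ Icc 0 T, ∀ i, ψ i t (x t) ≤ σ k + penaltyLevel μ η (γ k) := by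
  set ℓ := σ k + penaltyLevel μ η (γ k) with hℓdef
  have hac := fun i => hψ.absolutelyContinuousOnInterval_comp_curve hT i hx
  have hcont : ∀ i, ContinuousOn (fun t => ψ i t (x t)) (Icc 0 T) := fun i => by
    simpa [uIcc_of_le hT.le] using (hac i).continuousOn
  rw [ae_restrict_iff' measurableSet_Icc] at hu hd
  refine IsClosed.Icc_subset_of_forall_exists_gt (s := {t | ∀ i, ψ i t (x t) ≤ ℓ}) ?_ ?_ ?_
  · have : {t | ∀ i, ψ i t (x t) ≤ ℓ} ∩ Icc 0 T =
        (⋂ i, Icc 0 T ∩ (fun t => ψ i t (x t)) ⁻¹' Iic ℓ) ∩ Icc 0 T := by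
      ext t
      simp only [mem_inter_iff, mem_ofPred_eq, mem_iInter, mem_preimage, mem_Iic]
      exact ⟨fun h => ⟨fun i => ⟨h.2, h.1 i⟩, h.2⟩, fun h => ⟨fun i => (h.1 i).2, h.2⟩⟩
    rw [this]
    exact (isClosed_iInter fun i =>
      (hcont i).preimage_isClosed_of_isClosed isClosed_Icc isClosed_Iic).inter isClosed_Icc
  · intro i
    have := hx0 i
    rw [hℓdef]
    linarith
  rintro t ⟨htℓ, ht⟩ y hy
  have hev : ∀ᶠ s in 𝓝[≥] t, ∀ i, ψ i s (x s) ≤ ε := by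
    rw [eventually_all]
    intro i
    have h1 : ∀ᶠ s in 𝓝[Icc 0 T] t, ψ i s (x s) < ε :=
      (hcont i t (Ico_subset_Icc_self ht)).eventually_lt_const ((htℓ i).trans_lt hℓε)
    have h2 : 𝓝[≥] t ≤ 𝓝[Icc 0 T] t := by
      rw [← nhdsWithin_Icc_eq_nhdsGE ht.2]
      exact nhdsWithin_mono _ (Icc_subset_Icc_left ht.1)
    exact (h1.filter_mono h2).mono fun s hs => hs.le
  obtain ⟨s, hs, hsub⟩ := mem_nhdsGE_iff_exists_Icc_subset.1
    (inter_mem hev (Icc_mem_nhdsGE (lt_min ht.2 hy)))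
  have hs2 : s ≤ min T y := (hsub (right_mem_Icc.2 hs.le)).2.2
  have hsT := hs2.trans (min_le_left _ _)
  refine ⟨s, fun i => ?_, hs, hs2.trans (min_le_right _ _)⟩
  refine ((hac i).mono (c := t) (d := s) ?_).le_of_deriv_nonpos_above hs.le (htℓ i) ?_
  · rw [uIcc_of_le hT.le, uIcc_of_le hs.le]; exact Icc_subset_Icc ht.1 hsT
  filter_upwards [hu, hd] with p hup hdp hp hpℓ
  have hpI : p ∈ Ioo 0 T := ⟨ht.1.trans_lt hp.1, hp.2.trans_le hsT⟩
  have hpI' := Ioo_subset_Icc_self hpI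
  have hpε : ∀ j, ψ j p (x p) ≤ ε := (hsub (Ioo_subset_Icc_self hp)).1
  obtain ⟨c, hc, hxc⟩ := htube p hpI' (x p) hpε
  have h1 := hψ.hasDerivAt_comp_curve hT i hpI (hdp hpI' hpε)
  exact ⟨_, h1, (hpar.inner_penaltyField_le hψ hpI' hc hxc (hup hpI')
    (fun j => (hpε j).trans hεβ) hℓ hpℓ).trans (by norm_num)⟩

/-! ### Existence for the penalized equation -/

/-- Multiplication by a Lipschitz cutoff makes a bounded function that is Lipschitz on a set
globally Lipschitz. -/
theorem norm_cutoff_smul_sub_le {X F : Type*} [NormedAddCommGroup X] [NormedAddCommGroup F]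
    [NormedSpace ℝ F] {S : Set X} {χ : X → ℝ} {g : X → F} {A B : ℝ} (hB : 0 ≤ B)
    (hχ0 : ∀ x, 0 ≤ χ x) (hχ1 : ∀ x, χ x ≤ 1) (hχS : ∀ x, x ∉ S → χ x = 0)
    (hχl : ∀ x y, |χ x - χ y| ≤ A * ‖x - y‖)
    (hgb : ∀ x ∈ S, ‖g x‖ ≤ B) (hgl : ∀ x ∈ S, ∀ y ∈ S, ‖g x - g y‖ ≤ B * ‖x - y‖) (x y : X) :
    ‖χ x • g x - χ y • g y‖ ≤ (B + A * B) * ‖x - y‖ := by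
  have key : ∀ x y, x ∈ S → ‖χ x • g x - χ y • g y‖ ≤ (B + A * B) * ‖x - y‖ := by
    intro x y hx
    have h1 : |χ x - χ y| * ‖g x‖ ≤ A * ‖x - y‖ * B :=
      mul_le_mul (hχl x y) (hgb x hx) (norm_nonneg _) ((abs_nonneg _).trans (hχl x y))
    by_cases hy : y ∈ S
    · have h2 : χ x • g x - χ y • g y = χ y • (g x - g y) + (χ x - χ y) • g x := by
        rw [smul_sub, sub_smul]; abel
      rw [h2]
      refine (norm_add_le _ _).trans ?_
      rw [norm_smul, norm_smul, Real.norm_of_nonneg (hχ0 y), Real.norm_eq_abs]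
      have h3 : χ y * ‖g x - g y‖ ≤ 1 * (B * ‖x - y‖) :=
        mul_le_mul (hχ1 y) (hgl x hx y hy) (norm_nonneg _) zero_le_one
      linarith
    · rw [hχS y hy, zero_smul, sub_zero, norm_smul, Real.norm_eq_abs]
      rw [hχS y hy, sub_zero] at h1
      have : 0 ≤ B * ‖x - y‖ := by positivity
      linarith
  by_cases hx : x ∈ S
  · exact key x y hx
  by_cases hy : y ∈ S
  · rw [norm_sub_rev, norm_sub_rev x]; exact key y x hy
  · rw [hχS x hx, hχS y hy]
    have h1 := hχl x y
    rw [hχS x hx, hχS y hy, sub_zero, abs_zero] at h1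
    have : 0 ≤ A * ‖x - y‖ * B := mul_nonneg h1 hB
    have : 0 ≤ B * ‖x - y‖ := by positivity
    simp only [zero_smul, sub_self, norm_zero]
    linarith

/-- A cutoff that is `1` for `t² + ‖x‖² ≤ q` and vanishes for `t² + ‖x‖² ≥ r²`. The truncation of
the norm makes it Lipschitz in `x` on the whole space. -/
noncomputable def ballCutoff (r q t : ℝ) (x : EuclideanSpace ℝ (Fin n)) : ℝ :=
  max 0 (min 1 ((r ^ 2 - t ^ 2 - min ‖x‖ r ^ 2) / (r ^ 2 - q)))

theorem ballCutoff_eq_one {q t : ℝ} (hr : 0 < r) (hq : q < r ^ 2) {x : EuclideanSpace ℝ (Fin n)}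
    (hx : t ^ 2 + ‖x‖ ^ 2 ≤ q) : ballCutoff r q t x = 1 := by
  have h1 : min ‖x‖ r ^ 2 ≤ ‖x‖ ^ 2 :=
    pow_le_pow_left₀ (le_min (norm_nonneg _) hr.le) (min_le_left _ _) 2
  have h2 : 1 ≤ (r ^ 2 - t ^ 2 - min ‖x‖ r ^ 2) / (r ^ 2 - q) := by
    rw [one_le_div (by linarith)]; linarith
  rw [ballCutoff, min_eq_left h2, max_eq_right zero_le_one]

theorem ballCutoff_eq_zero {q t : ℝ} (hq : q < r ^ 2) {x : EuclideanSpace ℝ (Fin n)}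
    (hx : ¬ t ^ 2 + ‖x‖ ^ 2 ≤ r ^ 2) : ballCutoff r q t x = 0 := by
  have h1 : r ^ 2 - t ^ 2 - min ‖x‖ r ^ 2 ≤ 0 := by
    rcases min_cases ‖x‖ r with h | h <;> rw [h.1]
    · linarith
    · nlinarith [sq_nonneg t]
  have h2 : (r ^ 2 - t ^ 2 - min ‖x‖ r ^ 2) / (r ^ 2 - q) ≤ 0 :=
    div_nonpos_of_nonpos_of_nonneg h1 (by linarith)
  rw [ballCutoff]
  exact max_eq_left ((min_le_right _ _).trans h2)

theorem abs_ballCutoff_sub_le {q t : ℝ} (hr : 0 < r) (hq : q < r ^ 2)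
    (x y : EuclideanSpace ℝ (Fin n)) :
    |ballCutoff r q t x - ballCutoff r q t y| ≤ 2 * r / (r ^ 2 - q) * ‖x - y‖ := by
  have hq' : 0 < r ^ 2 - q := by linarith
  have h1 : |ballCutoff r q t x - ballCutoff r q t y| ≤
      |(r ^ 2 - t ^ 2 - min ‖x‖ r ^ 2) / (r ^ 2 - q) -
        (r ^ 2 - t ^ 2 - min ‖y‖ r ^ 2) / (r ^ 2 - q)| := by
    refine (abs_max_sub_max_le_max _ _ _ _).trans ?_
    rw [sub_zero, abs_zero, max_eq_right (abs_nonneg _)]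
    refine (abs_min_sub_min_le_max _ _ _ _).trans ?_
    rw [sub_self, abs_zero, max_eq_right (abs_nonneg _)]
  refine h1.trans ?_
  have h2 : (r ^ 2 - t ^ 2 - min ‖x‖ r ^ 2) / (r ^ 2 - q) -
      (r ^ 2 - t ^ 2 - min ‖y‖ r ^ 2) / (r ^ 2 - q) =
      (min ‖y‖ r - min ‖x‖ r) * (min ‖y‖ r + min ‖x‖ r) / (r ^ 2 - q) := by ring
  have h3 : |min ‖y‖ r - min ‖x‖ r| ≤ ‖x - y‖ := by
    refine (abs_min_sub_min_le_max _ _ _ _).trans ?_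
    rw [sub_self, abs_zero, max_eq_left (abs_nonneg _), norm_sub_rev]
    exact abs_norm_sub_norm_le _ _
  have h4 : |min ‖y‖ r + min ‖x‖ r| ≤ 2 * r := by
    rw [abs_of_nonneg (add_nonneg (le_min (norm_nonneg _) hr.le) (le_min (norm_nonneg _) hr.le))]
    linarith [min_le_right ‖y‖ r, min_le_right ‖x‖ r]
  rw [h2, abs_div, abs_mul, abs_of_pos hq', div_mul_eq_mul_div]
  refine div_le_div_of_nonneg_right ?_ hq'.le
  rw [mul_comm]
  exact mul_le_mul h4 h3 (abs_nonneg _) (by positivity)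

theorem MovingSetAssumptions.contDiffOn_penaltyTerm (hT : 0 < T)
    (hψ : MovingSetAssumptions T ψ r β η ρ) (g s : ℝ) :
    ContDiffOn ℝ 1 (fun p : ℝ × EuclideanSpace ℝ (Fin n) =>
      ∑ i, (g * Real.exp (g * (ψ i p.1 p.2 - s))) • gradient (ψ i p.1) p.2) (Icc 0 T ×ˢ univ) := by
  refine ContDiffOn.sum fun i _ => ContDiffOn.fun_smul ?_ (hψ.contDiffOn_gradient hT i)
  refine contDiffOn_const.mul (Real.contDiff_exp.comp_contDiffOn ?_)
  exact contDiffOn_const.mul (((hψ.contDiffOn i).of_le (by norm_num)).sub contDiffOn_const)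

/-- For a large penalty parameter the penalized equation has a solution from every point of the
enlarged set. The equation cut off outside the ball of radius `r` is solvable, and its solution
stays where the cutoff is `1`. -/
theorem PenaltyParameters.exists_isPenaltySolution (hT : 0 < T)
    (hpar : PenaltyParameters T f U ψ η μ γ σ) (hψ : MovingSetAssumptions T ψ r β η ρ)
    (hf : DynamicsAssumptions T f U r M) {ε q : ℝ} (hεβ : ε ≤ β) (hq : q < r ^ 2)
    (htube : ∀ t ∈ Icc 0 T, ∀ x, (∀ i, ψ i t x ≤ ε) →
      (∃ c ∈ movingSet ψ t, ‖x - c‖ ≤ 1) ∧ t ^ 2 + ‖x‖ ^ 2 ≤ q)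
    {k : ℕ} (hℓ : -β ≤ σ k + penaltyLevel μ η (γ k)) (hℓε : σ k + penaltyLevel μ η (γ k) < ε)
    {u : ℝ → EuclideanSpace ℝ (Fin m)} (hu : IsControl T U u) {b : EuclideanSpace ℝ (Fin n)}
    (hb : b ∈ enlargedSet ψ μ η (γ k) (σ k) 0) :
    ∃ x, IsPenaltySolution T f ψ (γ k) (σ k) b u x := by
  classical
  have hr := hψ.r_pos
  obtain ⟨a₀, ha₀⟩ := hu.nonempty hT
  -- a version of the control with all its values in `U`
  set v : ℝ → EuclideanSpace ℝ (Fin m) := fun t => if u t ∈ U then u t else a₀ with hv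
  have hvU : ∀ t, v t ∈ U := fun t => by rw [hv]; dsimp only; split_ifs with h <;> assumption
  have huv : ∀ᵐ t ∂volume.restrict (Icc 0 T), u t = v t := by
    filter_upwards [hu.2] with t ht
    rw [hv]; exact (if_pos ht).symm
  have hvm : AEMeasurable v (volume.restrict (Icc 0 T)) := hu.1.congr huv
  obtain ⟨K, hK0, hKb, hKl⟩ :=
    (hψ.contDiffOn_penaltyTerm hT (γ k) (σ k)).exists_bound_lipschitz_strip r
  have hM := hf.M_pos
  set S : ℝ → Set (EuclideanSpace ℝ (Fin n)) := fun t => {x | t ^ 2 + ‖x‖ ^ 2 ≤ r ^ 2}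
  have hSr : ∀ t x, x ∈ S t → x ∈ Metric.closedBall 0 r := fun t x hx => by
    rw [mem_closedBall_zero_iff]
    have : t ^ 2 + ‖x‖ ^ 2 ≤ r ^ 2 := hx
    exact (le_abs_self _).trans (abs_le_of_sq_le_sq (by nlinarith [sq_nonneg t]) hr.le)
  have hgb : ∀ t ∈ Icc 0 T, ∀ x ∈ S t, ‖penaltyField f ψ (γ k) (σ k) t x (v t)‖ ≤ M + K :=
    fun t ht x hx => (norm_sub_le _ _).trans
      (add_le_add (hf.bound t ht x hx _ (hvU t)) (hKb (t, x) ⟨ht, hSr t x hx⟩))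
  have hgl : ∀ t ∈ Icc 0 T, ∀ x ∈ S t, ∀ y ∈ S t,
      ‖penaltyField f ψ (γ k) (σ k) t x (v t) - penaltyField f ψ (γ k) (σ k) t y (v t)‖ ≤
        (M + K) * ‖x - y‖ := fun t ht x hx y hy => by
    have h1 := hf.norm_sub_le ht (hvU t) hx hy
    have h2 := hKl (t, x) ⟨ht, hSr t x hx⟩ (t, y) ⟨ht, hSr t y hy⟩
    rw [dist_eq_norm, Prod.dist_eq, dist_self, max_eq_right dist_nonneg, dist_eq_norm] at h2
    rw [penaltyField, penaltyField, sub_sub_sub_comm, add_mul]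
    exact (norm_sub_le _ _).trans (add_le_add h1 h2)
  have hχ0 : ∀ t (x : EuclideanSpace ℝ (Fin n)), 0 ≤ ballCutoff r q t x :=
    fun t x => le_max_left _ _
  have hχ1 : ∀ t (x : EuclideanSpace ℝ (Fin n)), ballCutoff r q t x ≤ 1 := fun t x =>
    max_le zero_le_one (min_le_left _ _)
  have hMK : 0 ≤ M + K := by positivity
  obtain ⟨x, hx, hx0, hd⟩ := exists_caratheodory_solution hT.le (B := M + K)
    (L := M + K + 2 * r / (r ^ 2 - q) * (M + K))
    (g := fun t x => ballCutoff r q t x • penaltyField f ψ (γ k) (σ k) t x (v t)) (by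
      have : 0 < r ^ 2 - q := by linarith
      positivity) b (fun x hx => by
      have hxm : AEMeasurable x (volume.restrict (Icc 0 T)) := hx.measurable.aemeasurable
      have hχm : Continuous fun t => ballCutoff r q t (x t) := by unfold ballCutoff; fun_prop
      exact hχm.aestronglyMeasurable.smul
        ((hf.aestronglyMeasurable hxm hvm).sub
          ((hψ.contDiffOn_penaltyTerm hT (γ k)
            (σ k)).continuousOn.aestronglyMeasurable_comp_strip hxm)))
    (fun t ht x => by
      by_cases hx : x ∈ S t
      · rw [norm_smul, Real.norm_of_nonneg (hχ0 t x)]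
        exact (mul_le_mul (hχ1 t x) (hgb t ht x hx) (norm_nonneg _) zero_le_one).trans_eq
          (one_mul _)
      · rw [ballCutoff_eq_zero hq hx]; simpa using hMK)
    (fun t ht x y => norm_cutoff_smul_sub_le hMK (hχ0 t) (hχ1 t)
      (fun x hx => ballCutoff_eq_zero hq hx) (abs_ballCutoff_sub_le hr hq) (hgb t ht) (hgl t ht)
      x y)
  have hd' : ∀ᵐ t ∂volume.restrict (Icc 0 T), (∀ i, ψ i t (x t) ≤ ε) →
      HasDerivAt x (penaltyField f ψ (γ k) (σ k) t (x t) (u t)) t := by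
    filter_upwards [hd, huv, ae_restrict_mem measurableSet_Icc] with t ht htu htI htε
    rwa [ballCutoff_eq_one hr hq (htube t htI _ htε).2, one_smul, ← htu] at ht
  have hle := hpar.le_level_of_penaltyField hT hψ hεβ (fun t ht x hx => (htube t ht x hx).1) hℓ hℓε
    hu.2 hx (by rwa [hx0]) hd'
  refine ⟨x, hx, hx0, ?_⟩
  filter_upwards [hd', ae_restrict_mem measurableSet_Icc] with t ht htI
  exact ht fun i => (hle t htI i).trans hℓε.le

end Penalty

section Sweeping

variable {n m I : ℕ} {T r β η ρ M : ℝ}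
  {f : ℝ → EuclideanSpace ℝ (Fin n) → EuclideanSpace ℝ (Fin m) → EuclideanSpace ℝ (Fin n)}
  {U : Set (EuclideanSpace ℝ (Fin m))} {ψ : Fin I → ℝ → EuclideanSpace ℝ (Fin n) → ℝ}
  {x₀ : EuclideanSpace ℝ (Fin n)}

/-! ### Uniqueness and the choice of a control for the sweeping process -/

/-- Two solutions for the same control coincide: by uniform prox-regularity the normal cone is
hypomonotone, and Gronwall's inequality applies to the squared distance. -/
theorem IsSweepingSolution.eqOn (hT : 0 < T) (hψ : MovingSetAssumptions T ψ r β η ρ)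
    (hf : DynamicsAssumptions T f U r M) {v : ℝ → EuclideanSpace ℝ (Fin m)}
    (hv : IsControl T U v) {y z : ℝ → EuclideanSpace ℝ (Fin n)}
    (hy : IsSweepingSolution T f ψ x₀ v y) (hz : IsSweepingSolution T f ψ x₀ v z) :
    EqOn z y (Icc 0 T) := by
  obtain ⟨hyac, hy0, hyd⟩ := hy
  obtain ⟨hzac, hz0, hzd⟩ := hz
  obtain ⟨c, hc0, hc⟩ := hψ.exists_mem_limitingNormalCone_iff hT
  have hM := hf.M_pos
  have hdiff : ∀ {x : ℝ → EuclideanSpace ℝ (Fin n)},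
      (∀ᵐ t ∂volume.restrict (Icc 0 T), ∃ w ∈ limitingNormalCone (movingSet ψ t) (x t),
        HasDerivAt x (f t (x t) (v t) - w) t) →
      ∀ᵐ t, t ∈ uIcc 0 T → DifferentiableAt ℝ x t := fun h => by
    rw [uIcc_of_le hT.le]
    filter_upwards [(ae_restrict_iff' measurableSet_Icc).1 h] with t ht htI
    obtain ⟨w, -, hw⟩ := ht htI
    exact hw.differentiableAt
  have hg : AbsolutelyContinuousOnInterval (fun t => ‖z t - y t‖ ^ 2) 0 T := by
    have h := (hzac.fun_sub hyac).norm
    simpa only [sq] using h.fun_mul h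
  have hκ : IntervalIntegrable
      (fun t => 2 * M + 2 * c * (2 * M + ‖deriv y t‖ + ‖deriv z t‖)) volume 0 T := by
    refine intervalIntegrable_const.add (IntervalIntegrable.const_mul ?_ _)
    exact (intervalIntegrable_const.add (hyac.intervalIntegrable_norm_deriv (hdiff hyd))).add
      (hzac.intervalIntegrable_norm_deriv (hdiff hzd))
  have key := hg.eq_zero_of_deriv_le_mul hT.le hκ (fun t => by positivity)
    (by simp [hy0, hz0]) (fun t _ => by positivity) (by
      filter_upwards [(ae_restrict_iff' measurableSet_Icc).1 hyd,
        (ae_restrict_iff' measurableSet_Icc).1 hzd, (ae_restrict_iff' measurableSet_Icc).1 hv.2]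
        with t hyt hzt hvt htI
      have ht := Ioo_subset_Icc_self htI
      obtain ⟨w₁, hw₁, hd₁⟩ := hyt ht
      obtain ⟨w₂, hw₂, hd₂⟩ := hzt ht
      have ha := hvt ht
      obtain ⟨hyC, h₁⟩ := (hc t ht _ _).1 hw₁
      obtain ⟨hzC, h₂⟩ := (hc t ht _ _).1 hw₂
      have hyr := (hψ.graph_in_ball t ht _ hyC).le
      have hzr := (hψ.graph_in_ball t ht _ hzC).le
      refine ⟨_, (hd₂.sub hd₁).norm_sq, ?_⟩
      have hn₁ : ‖w₁‖ ≤ M + ‖deriv y t‖ := by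
        rw [hd₁.deriv]
        have := norm_sub_le (f t (y t) (v t)) (f t (y t) (v t) - w₁)
        rw [sub_sub_cancel] at this
        linarith [hf.bound t ht _ hyr _ ha]
      have hn₂ : ‖w₂‖ ≤ M + ‖deriv z t‖ := by
        rw [hd₂.deriv]
        have := norm_sub_le (f t (z t) (v t)) (f t (z t) (v t) - w₂)
        rw [sub_sub_cancel] at this
        linarith [hf.bound t ht _ hzr _ ha]
      have e0 : inner ℝ (z t - y t) (f t (z t) (v t) - w₂ - (f t (y t) (v t) - w₁)) =
          inner ℝ (z t - y t) (f t (z t) (v t) - f t (y t) (v t)) + inner ℝ w₁ (z t - y t) +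
            inner ℝ w₂ (y t - z t) := by
        rw [show f t (z t) (v t) - w₂ - (f t (y t) (v t) - w₁) =
          (f t (z t) (v t) - f t (y t) (v t)) + w₁ - w₂ by abel, inner_sub_right, inner_add_right,
          ← neg_sub (z t) (y t), inner_neg_right, real_inner_comm w₁, real_inner_comm w₂]
        ring
      have e1 : inner ℝ (z t - y t) (f t (z t) (v t) - f t (y t) (v t)) ≤
          M * ‖z t - y t‖ ^ 2 := by
        refine (real_inner_le_norm _ _).trans ?_
        have := mul_le_mul_of_nonneg_left (hf.norm_sub_le ht ha hzr hyr) (norm_nonneg (z t - y t))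
        exact this.trans_eq (by ring)
      have e2 := h₁ _ hzC
      have e3 := h₂ _ hyC
      rw [norm_sub_rev (y t)] at e3
      have hsq : 0 ≤ c * ‖z t - y t‖ ^ 2 := by positivity
      have e4 := mul_le_mul_of_nonneg_left hn₁ hsq
      have e5 := mul_le_mul_of_nonneg_left hn₂ hsq
      change 2 * inner ℝ (z t - y t) _ ≤ _
      rw [e0]
      nlinarith)
  intro t ht
  have := key t ht
  rwa [sq_eq_zero_iff, norm_eq_zero, sub_eq_zero] at this

/-- A solution of the differential inclusion solves the sweeping process for a suitable control:
the admissible control values depend on `(t, x(t), x'(t))` through a closed relation. -/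
theorem IsSweepingInclusionSolution.exists_control (hT : 0 < T)
    (hψ : MovingSetAssumptions T ψ r β η ρ) (hf : DynamicsAssumptions T f U r M)
    {y : ℝ → EuclideanSpace ℝ (Fin n)} (hy : IsSweepingInclusionSolution T f U ψ x₀ y) :
    ∃ u : ℝ → EuclideanSpace ℝ (Fin m), IsControl T U u ∧ IsSweepingSolution T f ψ x₀ u y := by
  obtain ⟨hyac, hy0, hyd⟩ := hy
  have hne : U.Nonempty := by
    have : NeZero (volume.restrict (Icc 0 T)) := ⟨by
      rw [Ne, Measure.restrict_eq_zero, Real.volume_Icc]; simpa using hT⟩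
    obtain ⟨t, a, ha, -⟩ := hyd.exists
    exact ⟨a, ha⟩
  set Z : Set ((ℝ × EuclideanSpace ℝ (Fin n) × EuclideanSpace ℝ (Fin n)) ×
      EuclideanSpace ℝ (Fin m)) := {p | p.1.1 ∈ Icc 0 T} with hZ
  have hZc : IsClosed Z := isClosed_Icc.preimage (by fun_prop)
  have hΘ : ContinuousOn (fun p : (ℝ × EuclideanSpace ℝ (Fin n) × EuclideanSpace ℝ (Fin n)) ×
      EuclideanSpace ℝ (Fin m) => (p.1.1, p.1.2.1, f p.1.1 p.1.2.1 p.2 - p.1.2.2)) Z := by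
    have h1 : ContinuousOn (fun p : (ℝ × EuclideanSpace ℝ (Fin n) × EuclideanSpace ℝ (Fin n)) ×
        EuclideanSpace ℝ (Fin m) => f p.1.1 p.1.2.1 p.2) Z :=
      hf.continuousOn.comp (f := fun p : (ℝ × EuclideanSpace ℝ (Fin n) ×
        EuclideanSpace ℝ (Fin n)) × EuclideanSpace ℝ (Fin m) => (p.1.1, p.1.2.1, p.2))
        (by fun_prop) fun p hp => ⟨hp, mem_univ _⟩
    have h2 : Continuous fun p : (ℝ × EuclideanSpace ℝ (Fin n) × EuclideanSpace ℝ (Fin n)) ×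
        EuclideanSpace ℝ (Fin m) => p.1.1 := by fun_prop
    have h3 : Continuous fun p : (ℝ × EuclideanSpace ℝ (Fin n) × EuclideanSpace ℝ (Fin n)) ×
        EuclideanSpace ℝ (Fin m) => p.1.2.1 := by fun_prop
    have h4 : Continuous fun p : (ℝ × EuclideanSpace ℝ (Fin n) × EuclideanSpace ℝ (Fin n)) ×
        EuclideanSpace ℝ (Fin m) => p.1.2.2 := by fun_prop
    exact h2.continuousOn.prodMk (h3.continuousOn.prodMk (h1.sub h4.continuousOn))
  have hK := (hΘ.preimage_isClosed_of_isClosed hZc (hψ.isClosed_graph_limitingNormalCone hT)).inter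
    (hf.isCompact_U.isClosed.preimage continuous_snd)
  obtain ⟨s, hs, hsU, hsK⟩ := exists_measurable_selector hK hf.isCompact_U hne fun p hp => hp.2
  have hym : AEMeasurable y (volume.restrict (Icc 0 T)) :=
    ContinuousOn.aemeasurable (by simpa [uIcc_of_le hT.le] using hyac.continuousOn)
      measurableSet_Icc
  refine ⟨fun t => s (t, y t, deriv y t), ⟨hs.comp_aemeasurable ?_, ae_of_all _ fun t => hsU _⟩,
    hyac, hy0, ?_⟩
  · exact aemeasurable_id'.prodMk (hym.prodMk (measurable_deriv y).aemeasurable)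
  filter_upwards [hyd, ae_restrict_mem measurableSet_Icc] with t ht htI
  obtain ⟨a, ha, w, hw, hd⟩ := ht
  have hmem := hsK (t, y t, deriv y t) ⟨a, ⟨htI, htI, by
    change f t (y t) a - deriv y t ∈ _
    rwa [hd.deriv, sub_sub_cancel]⟩, ha⟩
  refine ⟨_, hmem.1.2.2, ?_⟩
  change HasDerivAt y (_ - (_ - deriv y t)) t
  rw [sub_sub_cancel, hd.deriv]
  exact hd

end Sweeping

section Convergence

open scoped NNReal

variable {n m I : ℕ} {T r β η ρ M μ : ℝ}
  {f : ℝ → EuclideanSpace ℝ (Fin n) → EuclideanSpace ℝ (Fin m) → EuclideanSpace ℝ (Fin n)}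
  {U : Set (EuclideanSpace ℝ (Fin m))} {ψ : Fin I → ℝ → EuclideanSpace ℝ (Fin n) → ℝ}
  {γ σ : ℕ → ℝ} {x₀ : EuclideanSpace ℝ (Fin n)}

/-! ### Velocities and multipliers -/

/-- For a control value and a vector of multipliers: the resulting velocity, the drift, and the
multipliers themselves. -/
noncomputable def velocityData
    (f : ℝ → EuclideanSpace ℝ (Fin n) → EuclideanSpace ℝ (Fin m) → EuclideanSpace ℝ (Fin n))
    (ψ : Fin I → ℝ → EuclideanSpace ℝ (Fin n) → ℝ) (t : ℝ) (x : EuclideanSpace ℝ (Fin n))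
    (p : EuclideanSpace ℝ (Fin m) × (Fin I → ℝ)) :
    EuclideanSpace ℝ (Fin n) × EuclideanSpace ℝ (Fin n) × (Fin I → ℝ) :=
  (f t x p.1 - ∑ i, p.2 i • gradient (ψ i t) x, f t x p.1, p.2)

/-- The multipliers `γ exp (γ (ψⁱ - σ))` of the penalized equation. -/
noncomputable def penaltyMultiplier (ψ : Fin I → ℝ → EuclideanSpace ℝ (Fin n) → ℝ) (g s t : ℝ)
    (x : EuclideanSpace ℝ (Fin n)) (i : Fin I) : ℝ :=
  g * Real.exp (g * (ψ i t x - s))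

theorem continuousOn_velocityData (hT : 0 < T) (hψ : MovingSetAssumptions T ψ r β η ρ)
    (hf : DynamicsAssumptions T f U r M) :
    ContinuousOn (fun z : (ℝ × EuclideanSpace ℝ (Fin n)) × EuclideanSpace ℝ (Fin m) ×
      (Fin I → ℝ) => velocityData f ψ z.1.1 z.1.2 z.2) {z | z.1.1 ∈ Icc 0 T} := by
  have h1 : ContinuousOn (fun z : (ℝ × EuclideanSpace ℝ (Fin n)) × EuclideanSpace ℝ (Fin m) ×
      (Fin I → ℝ) => f z.1.1 z.1.2 z.2.1) {z | z.1.1 ∈ Icc 0 T} :=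
    hf.continuousOn.comp (f := fun z : (ℝ × EuclideanSpace ℝ (Fin n)) ×
      EuclideanSpace ℝ (Fin m) × (Fin I → ℝ) => (z.1.1, z.1.2, z.2.1)) (by fun_prop)
      fun z hz => ⟨hz, mem_univ _⟩
  have h2 : ∀ i, ContinuousOn (fun z : (ℝ × EuclideanSpace ℝ (Fin n)) ×
      EuclideanSpace ℝ (Fin m) × (Fin I → ℝ) => gradient (ψ i z.1.1) z.1.2)
      {z | z.1.1 ∈ Icc 0 T} := fun i =>
    (hψ.continuousOn_gradient hT i).comp (f := fun z : (ℝ × EuclideanSpace ℝ (Fin n)) ×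
      EuclideanSpace ℝ (Fin m) × (Fin I → ℝ) => z.1) (by fun_prop) fun z hz => ⟨hz, mem_univ _⟩
  have h3 : ContinuousOn (fun z : (ℝ × EuclideanSpace ℝ (Fin n)) × EuclideanSpace ℝ (Fin m) ×
      (Fin I → ℝ) => z.2.2) {z | z.1.1 ∈ Icc 0 T} :=
    (continuous_snd.comp continuous_snd).continuousOn
  have h4 : ContinuousOn (fun z : (ℝ × EuclideanSpace ℝ (Fin n)) × EuclideanSpace ℝ (Fin m) ×
      (Fin I → ℝ) => ∑ i, z.2.2 i • gradient (ψ i z.1.1) z.1.2) {z | z.1.1 ∈ Icc 0 T} :=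
    continuousOn_finsetSum _ fun i _ => (continuousOn_pi.1 h3 i).smul (h2 i)
  exact (h1.sub h4).prodMk (h1.prodMk h3)

/-- The set of velocity data at a point is compact and convex, by the convexity of the set of
drifts. -/
theorem isCompact_convex_velocityData (hf : DynamicsAssumptions T f U r M) {t L : ℝ}
    (ht : t ∈ Icc 0 T) (x : EuclideanSpace ℝ (Fin n)) :
    IsCompact (velocityData f ψ t x '' (U ×ˢ Icc 0 fun _ => L)) ∧
      Convex ℝ (velocityData f ψ t x '' (U ×ˢ Icc 0 fun _ => L)) := by
  set Φ : EuclideanSpace ℝ (Fin n) × (Fin I → ℝ) →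
      EuclideanSpace ℝ (Fin n) × EuclideanSpace ℝ (Fin n) × (Fin I → ℝ) :=
    fun p => (p.1 - ∑ i, p.2 i • gradient (ψ i t) x, p.1, p.2) with hΦ
  have himg : velocityData f ψ t x '' (U ×ˢ Icc 0 fun _ => L) =
      Φ '' ((f t x '' U) ×ˢ Icc 0 fun _ => L) := by
    ext q
    constructor
    · rintro ⟨⟨a, l⟩, ⟨ha, hl⟩, rfl⟩
      exact ⟨(f t x a, l), ⟨mem_image_of_mem _ ha, hl⟩, rfl⟩
    · rintro ⟨⟨-, l⟩, ⟨⟨a, ha, rfl⟩, hl⟩, rfl⟩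
      exact ⟨(a, l), ⟨ha, hl⟩, rfl⟩
  have hlin : IsLinearMap ℝ Φ :=
    ⟨fun p q => by
      simp only [hΦ, Prod.fst_add, Prod.snd_add, Pi.add_apply, add_smul, Finset.sum_add_distrib,
        Prod.mk_add_mk, Prod.mk.injEq, and_true]
      abel, fun c p => by
      simp only [hΦ, Prod.smul_fst, Prod.smul_snd, Pi.smul_apply, smul_assoc, ← Finset.smul_sum,
        ← smul_sub, Prod.smul_mk]⟩
  have hΦc : Continuous Φ := by fun_prop
  have hfc : Continuous fun a => f t x a :=
    hf.continuousOn.comp_continuous (f := fun a => (t, x, a)) (by fun_prop)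
      fun a => ⟨ht, mem_univ _⟩
  rw [himg]
  exact ⟨((hf.isCompact_U.image hfc).prod isCompact_Icc).image hΦc,
    ((hf.convex_image t ht x).prod (convex_Icc _ _)).is_linear_image hlin⟩

/-- Near a point, velocity data are close to those at the point, uniformly in the control value and
in bounded multipliers. -/
theorem eventually_dist_velocityData_lt (hT : 0 < T) (hψ : MovingSetAssumptions T ψ r β η ρ)
    (hf : DynamicsAssumptions T f U r M) {t L ε : ℝ} (ht : t ∈ Icc 0 T)
    (x : EuclideanSpace ℝ (Fin n)) (hε : 0 < ε) :
    ∀ᶠ z : ℝ × EuclideanSpace ℝ (Fin n) in 𝓝 (t, x), z.1 ∈ Icc 0 T →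
      ∀ p ∈ U ×ˢ Icc (0 : Fin I → ℝ) fun _ => L,
        dist (velocityData f ψ z.1 z.2 p) (velocityData f ψ t x p) < ε := by
  have hcomp : IsCompact (U ×ˢ Icc (0 : Fin I → ℝ) fun _ => L) :=
    hf.isCompact_U.prod isCompact_Icc
  have key := hcomp.eventually_forall_of_forall_eventually (x₀ := (t, x))
    (P := fun z p => z.1 ∈ Icc 0 T →
      dist (velocityData f ψ z.1 z.2 p) (velocityData f ψ t x p) < ε) (fun p _ => by
    have hc := continuousOn_velocityData (I := I) hT hψ hf
    have hc' : ContinuousOn (fun z : (ℝ × EuclideanSpace ℝ (Fin n)) × EuclideanSpace ℝ (Fin m) ×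
        (Fin I → ℝ) => velocityData f ψ t x z.2) {z | z.1.1 ∈ Icc 0 T} :=
      hc.comp (f := fun z : (ℝ × EuclideanSpace ℝ (Fin n)) × EuclideanSpace ℝ (Fin m) ×
        (Fin I → ℝ) => ((t, x), z.2)) (by fun_prop) fun z _ => ht
    have h := (Filter.Tendsto.dist (hc ((t, x), p) ht)
      (hc' ((t, x), p) ht)).eventually_lt_const (u := ε) (by simpa using hε)
    exact eventually_nhdsWithin_iff.1 h)
  filter_upwards [key] with z hz hzI p hp using hz p hp hzI

/-- Properties that hold near `(t, y(t))` hold along the graphs of curves close to `y` at times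
close to `t`. -/
theorem exists_delta_of_eventually_nhds {F : Type*} [NormedAddCommGroup F] {x : ℕ → ℝ → F}
    {y : ℝ → F} {t : ℝ} {P : ℝ × F → Prop} (hy : ContinuousOn y (Icc 0 T)) (ht : t ∈ Icc 0 T)
    (hxy : TendstoUniformlyOn x y atTop (Icc 0 T)) (hP : ∀ᶠ p in 𝓝 (t, y t), P p) :
    ∃ δ > 0, ∀ᶠ k in atTop, ∀ s ∈ Icc 0 T, |s - t| < δ → P (s, x k s) := by
  obtain ⟨δ, hδ, hball⟩ := Metric.eventually_nhds_iff.1 hP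
  obtain ⟨δ', hδ', hyδ⟩ := Metric.continuousOn_iff.1 hy t ht (δ / 2) (half_pos hδ)
  refine ⟨min δ δ', lt_min hδ hδ', ?_⟩
  filter_upwards [Metric.tendstoUniformlyOn_iff.1 hxy (δ / 2) (half_pos hδ)] with k hk s hs hst
  refine hball ?_
  rw [Prod.dist_eq]
  refine max_lt (hst.trans_le (min_le_left _ _)) ?_
  calc dist (x k s) (y t) ≤ dist (x k s) (y s) + dist (y s) (y t) := dist_triangle _ _ _
    _ < δ / 2 + δ / 2 := add_lt_add (by rw [dist_comm]; exact hk s hs)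
        (hyδ s hs (hst.trans_le (min_le_right _ _)))
    _ = δ := add_halves δ

/-- The multipliers of strictly satisfied constraints vanish in the limit. -/
theorem tendsto_mul_exp_neg {c : ℝ} (hc : 0 < c) (hγ : Tendsto γ atTop atTop) :
    Tendsto (fun k => γ k * Real.exp (γ k * -c)) atTop (𝓝 0) := by
  have h := (Real.tendsto_pow_mul_exp_neg_atTop_nhds_zero 1).comp (hγ.atTop_mul_const hc)
  have h' := h.mul_const c⁻¹
  rw [zero_mul] at h'
  refine h'.congr fun k => ?_
  simp only [Function.comp_apply, pow_one, mul_neg]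
  field_simp

/-! ### Convergence of the penalized solutions -/

/-- A solution of the penalized equation in the enlarged sets: its velocity data are bounded and
measurable, and it is the primitive of its velocity. -/
theorem PenaltyParameters.exists_velocityData_bound (hT : 0 < T)
    (hpar : PenaltyParameters T f U ψ η μ γ σ) (hψ : MovingSetAssumptions T ψ r β η ρ)
    (hf : DynamicsAssumptions T f U r M) {ε q : ℝ} (hεβ : ε ≤ β) (hq : q < r ^ 2)
    (htube : ∀ t ∈ Icc 0 T, ∀ x, (∀ i, ψ i t x ≤ ε) →
      (∃ c ∈ movingSet ψ t, ‖x - c‖ ≤ 1) ∧ t ^ 2 + ‖x‖ ^ 2 ≤ q) :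
    ∃ B : ℝ, ∀ k, -β ≤ σ k + penaltyLevel μ η (γ k) → σ k + penaltyLevel μ η (γ k) < ε →
      ∀ b ∈ enlargedSet ψ μ η (γ k) (σ k) 0, ∀ u, IsControl T U u →
      ∀ x, IsPenaltySolution T f ψ (γ k) (σ k) b u x →
      (∀ t ∈ Icc 0 T, ∀ i, ψ i t (x t) ≤ σ k + penaltyLevel μ η (γ k)) ∧
      (∀ t ∈ Icc 0 T, penaltyMultiplier ψ (γ k) (σ k) t (x t) ∈
        Icc (0 : Fin I → ℝ) fun _ => |μ| / η ^ 2) ∧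
      IntegrableOn (fun t =>
        velocityData f ψ t (x t) (u t, penaltyMultiplier ψ (γ k) (σ k) t (x t))) (Icc 0 T) ∧
      (∀ᵐ t ∂volume.restrict (Icc 0 T),
        ‖velocityData f ψ t (x t) (u t, penaltyMultiplier ψ (γ k) (σ k) t (x t))‖ ≤ B) ∧
      ∀ t ∈ Icc 0 T, x t = b + ∫ s in (0:ℝ)..t,
        (velocityData f ψ s (x s) (u s, penaltyMultiplier ψ (γ k) (σ k) s (x s))).1 := by
  have hη := hψ.η_pos
  have hr := hψ.r_pos
  have hM := hf.M_pos
  obtain ⟨G, hG0, hG⟩ := hψ.exists_gradient_bound hT r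
  set L := |μ| / η ^ 2 with hL
  have hL0 : 0 ≤ L := by positivity
  refine ⟨M + I * (L * G) + L, fun k hℓ hℓε b hb u hu x hx => ?_⟩
  obtain ⟨hxac, hx0, hxd⟩ := hx
  have hγ := hpar.γ_pos k
  have hle := hpar.le_level_of_penaltyField hT hψ hεβ (fun t ht x hx => (htube t ht x hx).1) hℓ hℓε
    hu.2 hxac (by rwa [hx0]) (by filter_upwards [hxd] with t ht _ using ht)
  have htb := fun t ht => htube t ht (x t) fun i => (hle t ht i).trans hℓε.le
  have hxr : ∀ t ∈ Icc 0 T, x t ∈ Metric.closedBall 0 r := fun t ht => by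
    rw [mem_closedBall_zero_iff]
    have := (htb t ht).2
    exact (le_abs_self _).trans (abs_le_of_sq_le_sq (by nlinarith [sq_nonneg t]) hr.le)
  have hmul : ∀ t ∈ Icc 0 T, penaltyMultiplier ψ (γ k) (σ k) t (x t) ∈
      Icc (0 : Fin I → ℝ) fun _ => L := fun t ht => by
    refine ⟨fun i => by simp only [penaltyMultiplier, Pi.zero_apply]; positivity, fun i => ?_⟩
    obtain ⟨c, hc, -⟩ := (htb t ht).1
    have hμ : 0 < μ := one_pos.trans_le (hpar.one_le ht hc (hu.nonempty hT) i)
    refine (hpar.multiplier_le hη hμ (hle t ht i)).trans_eq ?_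
    rw [hL, abs_of_pos hμ]
  have hxm : AEMeasurable x (volume.restrict (Icc 0 T)) :=
    ContinuousOn.aemeasurable (by simpa [uIcc_of_le hT.le] using hxac.continuousOn)
      measurableSet_Icc
  have hmeas : AEStronglyMeasurable (fun t => velocityData f ψ t (x t)
      (u t, penaltyMultiplier ψ (γ k) (σ k) t (x t))) (volume.restrict (Icc 0 T)) := by
    have h1 := hf.aestronglyMeasurable hxm hu.1
    have h2 := (hψ.contDiffOn_penaltyTerm hT (γ k)
      (σ k)).continuousOn.aestronglyMeasurable_comp_strip hxm
    have h3 : ContinuousOn (fun p : ℝ × EuclideanSpace ℝ (Fin n) =>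
        penaltyMultiplier ψ (γ k) (σ k) p.1 p.2) (Icc 0 T ×ˢ univ) := by
      refine continuousOn_pi.2 fun i => ?_
      have := hψ.continuousOn_joint i
      unfold penaltyMultiplier
      fun_prop
    exact (h1.sub h2).prodMk (h1.prodMk (h3.aestronglyMeasurable_comp_strip hxm))
  have hbd : ∀ᵐ t ∂volume.restrict (Icc 0 T), ‖velocityData f ψ t (x t)
      (u t, penaltyMultiplier ψ (γ k) (σ k) t (x t))‖ ≤ M + I * (L * G) + L := by
    filter_upwards [hu.2, ae_restrict_mem measurableSet_Icc] with t hut ht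
    have h1 : ‖f t (x t) (u t)‖ ≤ M := hf.bound t ht _ ((htb t ht).2.trans hq.le) _ hut
    have hm := hmul t ht
    have hmi : ∀ i, ‖penaltyMultiplier ψ (γ k) (σ k) t (x t) i‖ ≤ L := fun i => by
      rw [Real.norm_of_nonneg (hm.1 i)]; exact hm.2 i
    have h2 : ‖∑ i, penaltyMultiplier ψ (γ k) (σ k) t (x t) i • gradient (ψ i t) (x t)‖ ≤
        I * (L * G) := by
      refine (norm_sum_le_of_le (f := fun i => penaltyMultiplier ψ (γ k) (σ k) t (x t) i •
        gradient (ψ i t) (x t)) Finset.univ (n := fun _ => L * G) fun i _ => ?_).trans_eq (by simp)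
      rw [norm_smul]
      exact mul_le_mul (hmi i) ((hG t ht i).1 _ (hxr t ht)) (norm_nonneg _) hL0
    have h3 : 0 ≤ I * (L * G) := by positivity
    refine max_le ?_ (max_le ?_ ?_)
    · exact (norm_sub_le _ _).trans (by linarith)
    · exact h1.trans (by linarith)
    · refine (pi_norm_le_iff_of_nonneg (by linarith)).2 fun i => (hmi i).trans (by linarith)
  have hint : IntegrableOn (fun t => velocityData f ψ t (x t)
      (u t, penaltyMultiplier ψ (γ k) (σ k) t (x t))) (Icc 0 T) := Integrable.of_bound hmeas _ hbd
  refine ⟨hle, hmul, hint, hbd, ?_⟩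
  rw [← hx0]
  exact hxac.eq_add_integral hT.le hint.fst
    (hbd.mono fun t ht => (norm_fst_le _).trans ht) hxd

end Convergence

section Limit

open scoped NNReal

variable {n m I : ℕ} {T r β η ρ M μ : ℝ}
  {f : ℝ → EuclideanSpace ℝ (Fin n) → EuclideanSpace ℝ (Fin m) → EuclideanSpace ℝ (Fin n)}
  {U : Set (EuclideanSpace ℝ (Fin m))} {ψ : Fin I → ℝ → EuclideanSpace ℝ (Fin n) → ℝ}
  {γ σ : ℕ → ℝ} {x₀ : EuclideanSpace ℝ (Fin n)}

/-- The derivative of a limit of primitives of velocity data is again a velocity datum, with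
vanishing multipliers for the strictly satisfied constraints; hence the limit curve has a velocity
in the sweeping inclusion. -/
theorem exists_velocity_of_tendsto (hT : 0 < T) (hψ : MovingSetAssumptions T ψ r β η ρ)
    (hf : DynamicsAssumptions T f U r M) {g s : ℕ → ℝ} (hg : Tendsto g atTop atTop)
    (hg0 : ∀ k, 0 < g k) (hs : Tendsto s atTop (𝓝 0)) {L : ℝ} {x : ℕ → ℝ → EuclideanSpace ℝ (Fin n)}
    {u : ℕ → ℝ → EuclideanSpace ℝ (Fin m)} (hu : ∀ k, IsControl T U (u k))
    (hmul : ∀ k, ∀ t ∈ Icc 0 T, penaltyMultiplier ψ (g k) (s k) t (x k t) ∈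
      Icc (0 : Fin I → ℝ) fun _ => L)
    (hint : ∀ k, IntegrableOn (fun t => velocityData f ψ t (x k t)
      (u k t, penaltyMultiplier ψ (g k) (s k) t (x k t))) (Icc 0 T))
    {Q : ℝ → EuclideanSpace ℝ (Fin n) × EuclideanSpace ℝ (Fin n) × (Fin I → ℝ)}
    (hQ : ContinuousOn Q (Icc 0 T))
    (hxQ : TendstoUniformlyOn x (fun t => (Q t).1) atTop (Icc 0 T))
    (hQlim : ∀ t ∈ Icc 0 T, ∀ t' ∈ Icc 0 T, Tendsto (fun k => ∫ p in t..t',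
      velocityData f ψ p (x k p)
      (u k p, penaltyMultiplier ψ (g k) (s k) p (x k p))) atTop (𝓝 (Q t' - Q t)))
    {t : ℝ} (ht : t ∈ Ioo 0 T) (hC : (Q t).1 ∈ movingSet ψ t)
    {Q' : EuclideanSpace ℝ (Fin n) × EuclideanSpace ℝ (Fin n) × (Fin I → ℝ)}
    (hd : HasDerivAt Q Q' t) :
    ∃ a ∈ U, ∃ w ∈ limitingNormalCone (movingSet ψ t) (Q t).1,
      Q'.2.1 = f t (Q t).1 a ∧ Q'.1 = f t (Q t).1 a - w := by
  classical
  have htI := Ioo_subset_Icc_self ht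
  have hyc : ContinuousOn (fun t => (Q t).1) (Icc 0 T) := hQ.fst
  obtain ⟨hKc, hKconv⟩ := isCompact_convex_velocityData (ψ := ψ) (L := L) hf htI (Q t).1
  have hmem : Q' ∈ velocityData f ψ t (Q t).1 '' (U ×ˢ Icc 0 fun _ => L) := by
    refine hasDerivAt_mem_of_tendsto_integral ht hKconv hKc.isClosed hint (hQlim t htI) hd
      fun ε hε => ?_
    obtain ⟨δ, hδ, hk⟩ := exists_delta_of_eventually_nhds hyc htI hxQ
      (eventually_dist_velocityData_lt (L := L) hT hψ hf htI (Q t).1 hε)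
    refine ⟨δ, hδ, hk.mono fun k hk => ?_⟩
    filter_upwards [(ae_restrict_iff' measurableSet_Icc).1 (hu k).2] with p hpu hp hpt
    have hpUL : (u k p, penaltyMultiplier ψ (g k) (s k) p (x k p)) ∈
      U ×ˢ Icc (0 : Fin I → ℝ) fun _ => L := ⟨hpu hp, hmul k p hp⟩
    exact Metric.mem_cthickening_of_dist_le _ _ _ _ (mem_image_of_mem _ hpUL)
      (hk p hp hpt hp _ hpUL).le
  have hinact : ∀ j, ψ j t (Q t).1 < 0 → Q'.2.2 j = 0 := by
    intro j hj
    refine hasDerivAt_mem_of_tendsto_integral (K := {z | z.2.2 j = 0}) ht ?_ ?_ hint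
      (hQlim t htI) hd fun ε hε => ?_
    · intro z hz z' hz' a b _ _ _
      have h1 : z.2.2 j = 0 := hz
      have h2 : z'.2.2 j = 0 := hz'
      simp [h1, h2]
    · exact isClosed_eq (by fun_prop) continuous_const
    obtain ⟨c, hc, hjc⟩ : ∃ c > 0, ψ j t (Q t).1 < -(2 * c) :=
      ⟨-ψ j t (Q t).1 / 3, by linarith, by linarith⟩
    have hev : ∀ᶠ z : ℝ × EuclideanSpace ℝ (Fin n) in 𝓝 (t, (Q t).1), z.1 ∈ Icc 0 T →
        ψ j z.1 z.2 < -(2 * c) := by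
      have := (hψ.continuousOn_joint j (t, (Q t).1) ⟨htI, mem_univ _⟩).eventually_lt_const hjc
      filter_upwards [eventually_nhdsWithin_iff.1 this] with z hz hzI using hz ⟨hzI, mem_univ _⟩
    obtain ⟨δ, hδ, hk⟩ := exists_delta_of_eventually_nhds hyc htI hxQ hev
    refine ⟨δ, hδ, ?_⟩
    filter_upwards [hk, hs.eventually_const_lt (show -c < 0 by linarith),
      (tendsto_mul_exp_neg hc hg).eventually_lt_const hε] with k hk hsk hgk
    refine Eventually.of_forall fun p hp hpt => ?_
    have h1 := hk p hp hpt hp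
    set l := penaltyMultiplier ψ (g k) (s k) p (x k p) with hl
    have h2 : l j ≤ ε := by
      refine le_trans ?_ hgk.le
      have : ψ j p (x k p) - s k ≤ -c := by linarith
      have := hg0 k
      rw [hl, penaltyMultiplier]
      gcongr
    have h3 : 0 ≤ l j := (hmul k p hp).1 j
    refine Metric.mem_cthickening_of_dist_le _
      (f p (x k p) (u k p) - ∑ i, l i • gradient (ψ i p) (x k p), f p (x k p) (u k p),
        Function.update l j 0) _ _ (by simp) ?_
    rw [velocityData, Prod.dist_eq, Prod.dist_eq, dist_self, dist_self,
      max_eq_right (le_max_left _ _), max_eq_right dist_nonneg]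
    refine (dist_pi_le_iff hε.le).2 fun i => ?_
    change dist (l i) (Function.update l j 0 i) ≤ ε
    rcases eq_or_ne i j with rfl | hij
    · rw [Function.update_self, dist_zero_right, Real.norm_of_nonneg h3]; exact h2
    · rw [Function.update_of_ne hij, dist_self]; exact hε.le
  obtain ⟨⟨a, l⟩, ⟨ha, hl⟩, rfl⟩ := hmem
  exact ⟨a, ha, _, hψ.sum_smul_gradient_mem_limitingNormalCone hT htI hC (l := l)
    (fun i => hl.1 i) hinact, rfl, rfl⟩

/-- Solutions of penalized equations with large parameters subconverge to a solution of the
sweeping inclusion. The second curve `A` is the limit of the integrals of the drifts; it identifies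
the drift of the limit curve. -/
theorem PenaltyParameters.exists_subseq_limit (hT : 0 < T)
    (hpar : PenaltyParameters T f U ψ η μ γ σ) (hψ : MovingSetAssumptions T ψ r β η ρ)
    (hf : DynamicsAssumptions T f U r M) {ns : ℕ → ℕ} (hns : Tendsto ns atTop atTop)
    {b : ℕ → EuclideanSpace ℝ (Fin n)} {u : ℕ → ℝ → EuclideanSpace ℝ (Fin m)}
    {x : ℕ → ℝ → EuclideanSpace ℝ (Fin n)} (hu : ∀ k, IsControl T U (u k))
    (hb : ∀ k, b k ∈ enlargedSet ψ μ η (γ (ns k)) (σ (ns k)) 0)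
    (hx : ∀ᶠ k in atTop, IsPenaltySolution T f ψ (γ (ns k)) (σ (ns k)) (b k) (u k) (x k))
    (hb0 : Tendsto b atTop (𝓝 x₀)) :
    ∃ φ : ℕ → ℕ, StrictMono φ ∧ ∃ (y A : ℝ → EuclideanSpace ℝ (Fin n)) (B : ℝ),
      TendstoUniformlyOn (fun k => x (φ k)) y atTop (Icc 0 T) ∧
      AbsolutelyContinuousOnInterval y 0 T ∧ y 0 = x₀ ∧
      (∀ k, AEStronglyMeasurable (fun t => f t (x (φ k) t) (u (φ k) t))
        (volume.restrict (Icc 0 T))) ∧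
      (∀ k, ∀ᵐ t ∂volume.restrict (Icc 0 T), ‖f t (x (φ k) t) (u (φ k) t)‖ ≤ B) ∧
      (∀ t ∈ Icc 0 T, Tendsto (fun k => ∫ s in (0:ℝ)..t, f s (x (φ k) s) (u (φ k) s)) atTop
        (𝓝 (A t))) ∧
      ∀ᵐ t ∂volume.restrict (Icc 0 T), ∃ a ∈ U, ∃ w ∈ limitingNormalCone (movingSet ψ t) (y t),
        HasDerivAt A (f t (y t) a) t ∧ HasDerivAt y (f t (y t) a - w) t := by
  have h0 : (0:ℝ) ∈ Icc 0 T := ⟨le_rfl, hT.le⟩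
  obtain ⟨ε, q, hε, hεβ, hq, htube⟩ := hψ.exists_tube
  obtain ⟨B, hB⟩ := hpar.exists_velocityData_bound hT hψ hf hεβ hq htube
  have hlev := (hpar.tendsto_level hψ.η_pos).comp hns
  obtain ⟨N, hN⟩ := eventually_atTop.1 (hx.and
    ((hlev.eventually_const_lt (neg_lt_zero.2 hψ.β_pos)).and (hlev.eventually_lt_const hε)))
  have hbd := fun k => hB (ns (k + N)) (hN (k + N) (Nat.le_add_left _ _)).2.1.le
    (hN (k + N) (Nat.le_add_left _ _)).2.2 (b (k + N)) (hb _) (u (k + N)) (hu _) (x (k + N))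
    (hN (k + N) (Nat.le_add_left _ _)).1
  set z : ℕ → ℝ → EuclideanSpace ℝ (Fin n) × EuclideanSpace ℝ (Fin n) × (Fin I → ℝ) := fun k t =>
    velocityData f ψ t (x (k + N) t) (u (k + N) t,
      penaltyMultiplier ψ (γ (ns (k + N))) (σ (ns (k + N))) t (x (k + N) t)) with hz
  have hle : ∀ k, ∀ t ∈ Icc 0 T, ∀ i, ψ i t (x (k + N) t) ≤
      σ (ns (k + N)) + penaltyLevel μ η (γ (ns (k + N))) := fun k => (hbd k).1
  have hmul := fun k => (hbd k).2.1
  have hint : ∀ k, IntegrableOn (z k) (Icc 0 T) := fun k => (hbd k).2.2.1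
  have hzB : ∀ k, ∀ᵐ t ∂volume.restrict (Icc 0 T), ‖z k t‖ ≤ B := fun k => (hbd k).2.2.2.1
  have hxint : ∀ k, ∀ t ∈ Icc 0 T, x (k + N) t = b (k + N) + ∫ s in (0:ℝ)..t, (z k s).1 :=
    fun k => (hbd k).2.2.2.2
  have hii : ∀ k, ∀ {t t' : ℝ}, t ∈ Icc 0 T → t' ∈ Icc 0 T →
      IntervalIntegrable (z k) volume t t' := fun k t t' ht ht' =>
    IntegrableOn.intervalIntegrable ((hint k).mono_set (uIcc_subset_Icc ht ht'))
  set P : ℕ → ℝ → EuclideanSpace ℝ (Fin n) × EuclideanSpace ℝ (Fin n) × (Fin I → ℝ) := fun k t =>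
    (b (k + N), 0, 0) + ∫ s in (0:ℝ)..t, z k s with hP
  have hP1 : ∀ k, ∀ t ∈ Icc 0 T, (P k t).1 = x (k + N) t := fun k t ht => by
    rw [hxint k t ht]
    have := (ContinuousLinearMap.fst ℝ (EuclideanSpace ℝ (Fin n))
      (EuclideanSpace ℝ (Fin n) × (Fin I → ℝ))).intervalIntegral_comp_comm (hii k h0 ht)
    simp only [ContinuousLinearMap.coe_fst'] at this
    rw [this]
    rfl
  have hP2 : ∀ k, ∀ t ∈ Icc 0 T, (P k t).2.1 = ∫ s in (0:ℝ)..t, (z k s).2.1 := fun k t ht => by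
    have := ((ContinuousLinearMap.fst ℝ (EuclideanSpace ℝ (Fin n)) (Fin I → ℝ)).comp
      (ContinuousLinearMap.snd ℝ (EuclideanSpace ℝ (Fin n))
      (EuclideanSpace ℝ (Fin n) × (Fin I → ℝ)))).intervalIntegral_comp_comm (hii k h0 ht)
    simp only [ContinuousLinearMap.comp_apply, ContinuousLinearMap.coe_fst',
      ContinuousLinearMap.coe_snd'] at this
    rw [this, hP]
    simp
  have hPlip : ∀ k, LipschitzOnWith B.toNNReal (P k) (Icc 0 T) := fun k => by
    refine LipschitzOnWith.of_dist_le_mul fun s hs t ht => ?_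
    rw [hP]
    simp only [dist_add_left]
    exact (lipschitzOnWith_primitive hT.le (hint k) (hzB k)).dist_le_mul s hs t ht
  obtain ⟨R, hR⟩ := (Metric.isBounded_range_of_tendsto b hb0).exists_norm_le
  obtain ⟨φ, hφ, Q, hQlip, hPQ⟩ := exists_subseq_tendstoUniformlyOn_of_lipschitz hT.le hPlip
    (R := R) fun k => by
      have h1 : ‖b (k + N)‖ ≤ R := hR _ (mem_range_self _)
      have h2 : 0 ≤ R := (norm_nonneg _).trans h1
      simp only [hP, intervalIntegral.integral_same, add_zero]
      exact max_le h1 (by simpa using h2)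
  have hxQ : TendstoUniformlyOn (fun k => x (φ k + N)) (fun t => (Q t).1) atTop (Icc 0 T) := by
    rw [Metric.tendstoUniformlyOn_iff] at hPQ ⊢
    intro e he
    filter_upwards [hPQ e he] with k hk t ht
    rw [← hP1 _ t ht]
    refine lt_of_le_of_lt ?_ (hk t ht)
    rw [Prod.dist_eq]
    exact le_max_left _ _
  have hφN : Tendsto (fun k => φ k + N) atTop atTop :=
    tendsto_atTop_mono (fun k => Nat.le_add_right _ _) hφ.tendsto_atTop
  have hnsφ := hns.comp hφN
  have hPpt : ∀ t ∈ Icc 0 T, Tendsto (fun k => P (φ k) t) atTop (𝓝 (Q t)) := fun t ht =>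
    hPQ.tendsto_at ht
  have hC : ∀ t ∈ Icc 0 T, (Q t).1 ∈ movingSet ψ t := fun t ht i =>
    le_of_tendsto_of_tendsto' (((hψ.continuous_slice i ht).tendsto _).comp (hxQ.tendsto_at ht))
      (hlev.comp hφN) fun k => hle (φ k) t ht i
  refine ⟨fun k => φ k + N, hφ.add_const N, fun t => (Q t).1, fun t => (Q t).2.1, B, hxQ, ?_, ?_,
    ?_, ?_, ?_, ?_⟩
  · refine LipschitzOnWith.absolutelyContinuousOnInterval (K := B.toNNReal) ?_
    rw [uIcc_of_le hT.le]
    refine LipschitzOnWith.of_dist_le_mul fun s hs t ht => le_trans ?_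
      (hQlip.dist_le_mul s hs t ht)
    rw [Prod.dist_eq]
    exact le_max_left _ _
  · have h1 := (continuous_fst.tendsto _).comp (hPpt 0 h0)
    have h2 : Tendsto (fun k => b (φ k + N)) atTop (𝓝 x₀) := hb0.comp hφN
    refine tendsto_nhds_unique h1 (h2.congr fun k => ?_)
    simp [hP]
  · exact fun k => (hint (φ k)).1.snd.fst
  · exact fun k => (hzB (φ k)).mono fun t ht =>
      ((norm_fst_le _).trans (norm_snd_le (z (φ k) t))).trans ht
  · intro t ht
    have h1 := (continuous_snd.fst.tendsto _).comp (hPpt t ht)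
    exact h1.congr fun k => hP2 (φ k) t ht
  · rw [← restrict_Ioo_eq_restrict_Icc, ae_restrict_iff' measurableSet_Ioo]
    filter_upwards [hQlip.ae_differentiableWithinAt_of_mem_real] with t htd ht
    have htI := Ioo_subset_Icc_self ht
    have hd := ((htd htI).differentiableAt (Icc_mem_nhds ht.1 ht.2)).hasDerivAt
    obtain ⟨a, ha, w, hw, e1, e2⟩ := exists_velocity_of_tendsto hT hψ hf
      (g := fun k => γ (ns (φ k + N))) (s := fun k => σ (ns (φ k + N)))
      (x := fun k => x (φ k + N)) (u := fun k => u (φ k + N)) (hpar.γ_tendsto.comp hnsφ)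
      (fun k => hpar.γ_pos _) (hpar.σ_tendsto.comp hnsφ) (fun k => hu _) (fun k => hmul (φ k))
      (fun k => hint (φ k)) hQlip.continuousOn hxQ (fun t ht t' ht' => by
        refine ((hPpt t' ht').sub (hPpt t ht)).congr fun k => ?_
        simp only [hP, add_sub_add_left_eq_sub]
        exact intervalIntegral.integral_interval_sub_left (hii (φ k) h0 ht') (hii (φ k) h0 ht))
      ht (hC t htI) hd
    refine ⟨a, ha, w, hw, ?_, ?_⟩
    · rw [← e1]
      exact hd.snd.fst
    · rw [← e2]
      exact hd.fst

end Limit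

/-! ### Convergence for a fixed control -/

section Main

variable {n m I : ℕ} {T r β η ρ M μ : ℝ}
  {f : ℝ → EuclideanSpace ℝ (Fin n) → EuclideanSpace ℝ (Fin m) → EuclideanSpace ℝ (Fin n)}
  {U : Set (EuclideanSpace ℝ (Fin m))} {ψ : Fin I → ℝ → EuclideanSpace ℝ (Fin n) → ℝ}
  {γ σ : ℕ → ℝ} {x₀ : EuclideanSpace ℝ (Fin n)}

/-- For a fixed control, penalized solutions subconverge to a solution of the sweeping process with
this control: the integrals of the drifts converge by dominated convergence. -/
theorem PenaltyParameters.exists_subseq_tendsto_isSweepingSolution (hT : 0 < T)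
    (hpar : PenaltyParameters T f U ψ η μ γ σ) (hψ : MovingSetAssumptions T ψ r β η ρ)
    (hf : DynamicsAssumptions T f U r M) {ns : ℕ → ℕ} (hns : Tendsto ns atTop atTop)
    {b : ℕ → EuclideanSpace ℝ (Fin n)} {u : ℝ → EuclideanSpace ℝ (Fin m)}
    {x : ℕ → ℝ → EuclideanSpace ℝ (Fin n)} (hu : IsControl T U u)
    (hb : ∀ k, b k ∈ enlargedSet ψ μ η (γ (ns k)) (σ (ns k)) 0)
    (hx : ∀ᶠ k in atTop, IsPenaltySolution T f ψ (γ (ns k)) (σ (ns k)) (b k) u (x k))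
    (hb0 : Tendsto b atTop (𝓝 x₀)) :
    ∃ φ : ℕ → ℕ, StrictMono φ ∧ ∃ y : ℝ → EuclideanSpace ℝ (Fin n),
      TendstoUniformlyOn (fun k => x (φ k)) y atTop (Icc 0 T) ∧
      IsSweepingSolution T f ψ x₀ u y := by
  obtain ⟨φ, hφ, y, A, B, hxy, hyac, hy0, hmeas, hbd, hA, hd⟩ :=
    hpar.exists_subseq_limit hT hψ hf hns (fun _ => hu) hb hx hb0
  refine ⟨φ, hφ, y, hxy, hyac, hy0, ?_⟩
  have hlim : ∀ t ∈ Icc 0 T,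
      Tendsto (fun k => f t (x (φ k) t) (u t)) atTop (𝓝 (f t (y t) (u t))) := fun t ht => by
    have hc : Continuous fun z => f t z (u t) := (hf.contDiff t ht (u t)).continuous
    exact (hc.tendsto _).comp (hxy.tendsto_at ht)
  have hFm : AEStronglyMeasurable (fun t => f t (y t) (u t)) (volume.restrict (Icc 0 T)) :=
    hf.aestronglyMeasurable (ContinuousOn.aemeasurable
      (by simpa [uIcc_of_le hT.le] using hyac.continuousOn) measurableSet_Icc) hu.1
  have hFb : ∀ᵐ t ∂volume.restrict (Icc 0 T), ‖f t (y t) (u t)‖ ≤ B := by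
    filter_upwards [ae_all_iff.2 hbd, ae_restrict_mem measurableSet_Icc] with t ht htI
    exact le_of_tendsto' (hlim t htI).norm ht
  have hFi : IntervalIntegrable (fun t => f t (y t) (u t)) volume 0 T := by
    refine IntegrableOn.intervalIntegrable ?_
    rw [uIcc_of_le hT.le]
    exact Integrable.of_bound hFm B hFb
  have hAeq : EqOn A (fun t => ∫ s in (0:ℝ)..t, f s (y s) (u s)) (Icc 0 T) := fun t ht => by
    have hsub : uIoc 0 t ⊆ Icc 0 T := by
      rw [uIoc_of_le ht.1]; exact fun s hs => ⟨hs.1.le, hs.2.trans ht.2⟩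
    refine tendsto_nhds_unique (hA t ht)
      (intervalIntegral.tendsto_integral_filter_of_dominated_convergence (fun _ => B) ?_ ?_ ?_ ?_)
    · exact Eventually.of_forall fun k => (hmeas k).mono_measure (Measure.restrict_mono_set _ hsub)
    · refine Eventually.of_forall fun k => ?_
      filter_upwards [(ae_restrict_iff' measurableSet_Icc).1 (hbd k)] with s hs hst
      exact hs (hsub hst)
    · exact intervalIntegrable_const
    · exact Eventually.of_forall fun s hs => hlim s (hsub hs)
  rw [← restrict_Ioo_eq_restrict_Icc, ae_restrict_iff' measurableSet_Ioo] at hd ⊢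
  filter_upwards [hd, hFi.ae_hasDerivAt_integral] with t ht hFt htI
  obtain ⟨a, -, w, hw, hAd, hyd⟩ := ht htI
  have h1 := hFt (by rw [uIcc_of_le hT.le]; exact Ioo_subset_Icc_self htI) 0 left_mem_uIcc
  have h2 : A =ᶠ[𝓝 t] fun t => ∫ s in (0:ℝ)..t, f s (y s) (u s) := by
    filter_upwards [Ioo_mem_nhds htI.1 htI.2] with s hs using hAeq (Ioo_subset_Icc_self hs)
  rw [hAd.unique (h1.congr_of_eventuallyEq h2)] at hyd
  exact ⟨w, hw, hyd⟩

/-- For a fixed control, the whole sequence of penalized solutions converges, by uniqueness of the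
limit. -/
theorem PenaltyParameters.exists_tendstoUniformlyOn_isSweepingSolution (hT : 0 < T)
    (hpar : PenaltyParameters T f U ψ η μ γ σ) (hψ : MovingSetAssumptions T ψ r β η ρ)
    (hf : DynamicsAssumptions T f U r M)
    {b : ℕ → EuclideanSpace ℝ (Fin n)} {u : ℝ → EuclideanSpace ℝ (Fin m)}
    {x : ℕ → ℝ → EuclideanSpace ℝ (Fin n)} (hu : IsControl T U u)
    (hb : ∀ k, b k ∈ enlargedSet ψ μ η (γ k) (σ k) 0)
    (hx : ∀ᶠ k in atTop, IsPenaltySolution T f ψ (γ k) (σ k) (b k) u (x k))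
    (hb0 : Tendsto b atTop (𝓝 x₀)) :
    ∃ y : ℝ → EuclideanSpace ℝ (Fin n), TendstoUniformlyOn x y atTop (Icc 0 T) ∧
      IsSweepingSolution T f ψ x₀ u y := by
  obtain ⟨-, -, y, -, hy⟩ := hpar.exists_subseq_tendsto_isSweepingSolution hT hψ hf tendsto_id hu
    hb hx hb0
  refine ⟨y, tendstoUniformlyOn_of_subseq fun φ hφ => ?_, hy⟩
  obtain ⟨θ, hθ, z, hxz, hz⟩ := hpar.exists_subseq_tendsto_isSweepingSolution hT hψ hf
    hφ.tendsto_atTop hu (fun k => hb (φ k)) (hφ.tendsto_atTop.eventually hx)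
    (hb0.comp hφ.tendsto_atTop)
  exact ⟨θ, hθ, hxz.congr_right (hy.eqOn hT hψ hf hu hz)⟩

end Main

theorem theorem1 {n m I : ℕ} (T : ℝ) (hT : 0 < T)
    (f : ℝ → EuclideanSpace ℝ (Fin n) → EuclideanSpace ℝ (Fin m) → EuclideanSpace ℝ (Fin n))
    (U : Set (EuclideanSpace ℝ (Fin m)))
    (ψ : Fin I → ℝ → EuclideanSpace ℝ (Fin n) → ℝ)
    (r β η ρ M μ : ℝ) (γ σ : ℕ → ℝ)
    (hψ : MovingSetAssumptions T ψ r β η ρ)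
    (hf : DynamicsAssumptions T f U r M)
    (hpar : PenaltyParameters T f U ψ η μ γ σ)
    (x₀ : EuclideanSpace ℝ (Fin n)) :
    -- convergence of a subsequence to the unique solution for some control
    (∀ (b : ℕ → EuclideanSpace ℝ (Fin n)) (u : ℕ → ℝ → EuclideanSpace ℝ (Fin m))
        (x : ℕ → ℝ → EuclideanSpace ℝ (Fin n)),
        (∀ k, IsControl T U (u k)) →
        (∀ k, b k ∈ enlargedSet ψ μ η (γ k) (σ k) 0) →
        (∀ k, IsPenaltySolution T f ψ (γ k) (σ k) (b k) (u k) (x k)) →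
        Tendsto b atTop (𝓝 x₀) →
        ∃ (φ : ℕ → ℕ) (y : ℝ → EuclideanSpace ℝ (Fin n)) (v : ℝ → EuclideanSpace ℝ (Fin m)),
          StrictMono φ ∧ TendstoUniformlyOn (fun k => x (φ k)) y atTop (Icc 0 T) ∧
          IsControl T U v ∧ IsSweepingSolution T f ψ x₀ v y ∧
          ∀ z, IsSweepingSolution T f ψ x₀ v z → EqOn z y (Icc 0 T)) ∧
    -- uniqueness of the solution for every given control
    (∀ (v : ℝ → EuclideanSpace ℝ (Fin m)) (y z : ℝ → EuclideanSpace ℝ (Fin n)),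
        IsControl T U v → IsSweepingSolution T f ψ x₀ v y → IsSweepingSolution T f ψ x₀ v z →
        EqOn z y (Icc 0 T)) ∧
    -- if all the controls are equal, the limit is the unique solution for that control
    (∀ (b : ℕ → EuclideanSpace ℝ (Fin n)) (u : ℝ → EuclideanSpace ℝ (Fin m))
        (x : ℕ → ℝ → EuclideanSpace ℝ (Fin n)),
        IsControl T U u →
        (∀ k, b k ∈ enlargedSet ψ μ η (γ k) (σ k) 0) →
        (∀ k, IsPenaltySolution T f ψ (γ k) (σ k) (b k) u (x k)) →
        Tendsto b atTop (𝓝 x₀) →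
        ∃ y : ℝ → EuclideanSpace ℝ (Fin n),
          TendstoUniformlyOn x y atTop (Icc 0 T) ∧ IsSweepingSolution T f ψ x₀ u y ∧
          ∀ z, IsSweepingSolution T f ψ x₀ u z → EqOn z y (Icc 0 T)) ∧
    -- every solution of the inclusion is a uniform limit of solutions of the penalized equations
    (∀ y : ℝ → EuclideanSpace ℝ (Fin n), IsSweepingInclusionSolution T f U ψ x₀ y →
        ∃ u : ℝ → EuclideanSpace ℝ (Fin m),
          IsControl T U u ∧ IsSweepingSolution T f ψ x₀ u y ∧
          ∀ b : ℕ → EuclideanSpace ℝ (Fin n),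
            (∀ k, b k ∈ enlargedSet ψ μ η (γ k) (σ k) 0) → Tendsto b atTop (𝓝 x₀) →
            ∃ x : ℕ → ℝ → EuclideanSpace ℝ (Fin n),
              (∀ᶠ k in atTop, IsPenaltySolution T f ψ (γ k) (σ k) (b k) u (x k)) ∧
              TendstoUniformlyOn x y atTop (Icc 0 T)) := by
  refine ⟨fun b u x hu hb hx hb0 => ?_, fun v y z hv hy hz => hy.eqOn hT hψ hf hv hz,
    fun b u x hu hb hx hb0 => ?_, fun y hy => ?_⟩
  · obtain ⟨φ, hφ, y, A, B, hxy, hyac, hy0, -, -, -, hd⟩ :=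
      hpar.exists_subseq_limit hT hψ hf tendsto_id hu hb (Eventually.of_forall hx) hb0
    have hincl : IsSweepingInclusionSolution T f U ψ x₀ y :=
      ⟨hyac, hy0, hd.mono fun t ⟨a, ha, w, hw, _, h⟩ => ⟨a, ha, w, hw, h⟩⟩
    obtain ⟨v, hv, hyv⟩ := hincl.exists_control hT hψ hf
    exact ⟨φ, y, v, hφ, hxy, hv, hyv, fun z hz => hyv.eqOn hT hψ hf hv hz⟩
  · obtain ⟨y, hxy, hy⟩ := hpar.exists_tendstoUniformlyOn_isSweepingSolution hT hψ hf hu hb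
      (Eventually.of_forall hx) hb0
    exact ⟨y, hxy, hy, fun z hz => hy.eqOn hT hψ hf hu hz⟩
  · obtain ⟨u, hu, hyu⟩ := hy.exists_control hT hψ hf
    refine ⟨u, hu, hyu, fun b hb hb0 => ?_⟩
    obtain ⟨ε, q, hε, hεβ, hq, htube⟩ := hψ.exists_tube
    have hex : ∀ᶠ k in atTop, ∃ x, IsPenaltySolution T f ψ (γ k) (σ k) (b k) u x := by
      have hlev := hpar.tendsto_level hψ.η_pos
      filter_upwards [hlev.eventually_const_lt (neg_lt_zero.2 hψ.β_pos),
        hlev.eventually_lt_const hε] with k h1 h2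
      exact hpar.exists_isPenaltySolution hT hψ hf hεβ hq htube h1.le h2 hu (hb k)
    obtain ⟨x, hx⟩ := hex.choice
    obtain ⟨z, hxz, hz⟩ :=
      hpar.exists_tendstoUniformlyOn_isSweepingSolution hT hψ hf hu hb hx hb0
    exact ⟨x, hx, hxz.congr_right (hyu.eqOn hT hψ hf hu hz)⟩
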